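/- Let $\mathcal A$ be a finite alphabet, $\mathcal H_E$ a finite-dimensional Hilbert space, and let $\rho=\sum_{a\in\mathcal A}P(a)|a\rangle\langle a|\otimes\rho_a$ be a classical-quantum state, where $P$ is a probability distribution on $\mathcal A$ and each $\rho_a$ is a density matrix on $\mathcal H_E$. Logarithms are natural. Write $\rho^A,\rho^E$ for the reduced states, $H(\sigma)=-\mathrm{Tr}\,\sigma\log\sigma$, $H(A|\rho)=H(\rho^A)$, $H(A|E|\rho)=H(\rho)-H(\rho^E)$ and $I(A:E|\rho)=\mathrm{Tr}\,\rho(\log\rho-\log(\rho^A\otimes\rho^E))$. When a map $f$ is applied to the classical part, the state becomes $\sum_a P(a)|f(a)\rangle\langle f(a)|\otimes\rho_a$, and the corresponding quantities are written $H(f(A)|\rho)$, $H(f(A)|E|\rho)$, $I(f(A):E|\rho)$. For $R>0$ let $\mathcal F_R(\rho)$ be the set of sequences of maps $f_n:\mathcal A^n\to\{1,\dots,\lfloor e^{nR}\rfloor\}$ whose output is asymptotically uniform in the sense that $\lim_{n\to\infty}\frac{H(f_n(A)|\rho^{\otimes n})}{nR}=1$. The equivocation rate is $$\mathcal R(R|\rho):=\sup_{\{f_n\}\in\mathcal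 F_R(\rho)}\ \lim_{n\to\infty}\frac{H(f_n(A)|E|\rho^{\otimes n})}{n},$$ the supremum being over those sequences in $\mathcal F_R(\rho)$ for which the limit exists. Theorem. If $H(A|E|\rho)<R\le H(A|\rho)$, then $$\mathcal R(R|\rho)=H(A|E|\rho).$$ Moreover, for every $R$ with $0<R\le H(A|\rho)$, the minimal leaked-information rate is $$\inf_{\{f_n\}\in\mathcal F_R(\rho)}\ \lim_{n\to\infty}\frac{I(f_n(A):E|\rho^{\otimes n})}{n}=\max\{R-H(A|E|\rho),0\},$$ the infimum again being over the sequences for which the limit exists. -/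

import Mathlib

open Filter Topology
open scoped Matrix Kronecker ComplexOrder

/-- Density matrices: positive semidefinite complex matrices of trace one. -/
structure IsDensityMatrix {d : Type*} [Fintype d] (ρ : Matrix d d ℂ) : Prop where
  posSemidef : ρ.PosSemidef
  trace_eq_one : ρ.trace = 1

/-- A classical-quantum ensemble: a probability distribution `prob` on the finite alphabet `α`
and, for every letter, a state `state a` of the finite-dimensional quantum system with basis
`ε`. -/
structure CQEnsemble (α ε : Type*) [Fintype α] [Fintype ε] where
  prob : α → ℝ
  prob_nonneg : ∀ a, 0 ≤ prob a
  prob_sum : ∑ a, prob a = 1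
  state : α → Matrix ε ε ℂ
  state_isDensity : ∀ a, IsDensityMatrix (state a)

noncomputable section

/-- The composite state `∑ a, P(a) |a⟩⟨a| ⊗ ρ_a`. -/
def CQEnsemble.toMatrix {α ε : Type*} [Fintype α] [DecidableEq α] [Fintype ε]
    (ρ : CQEnsemble α ε) : Matrix (α × ε) (α × ε) ℂ :=
  ∑ a, (ρ.prob a : ℂ) • (Matrix.single a a (1 : ℂ) ⊗ₖ ρ.state a)

/-- The logarithm of a Hermitian matrix by functional calculus (with the value `0` on the
kernel). -/
def matrixLog {d : Type*} [Fintype d] [DecidableEq d] (ρ : Matrix d d ℂ) : Matrix d d ℂ :=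
  cfc Real.log ρ

/-- The von Neumann entropy `-Tr ρ log ρ` (in nats). -/
def vonNeumannEntropy {d : Type*} [Fintype d] [DecidableEq d] (ρ : Matrix d d ℂ) : ℝ :=
  -(ρ * matrixLog ρ).trace.re

/-- The reduced state on the second system, `ρ^E = Tr_A ρ`. -/
def reducedE {α ε : Type*} [Fintype α] (ρ : Matrix (α × ε) (α × ε) ℂ) : Matrix ε ε ℂ :=
  Matrix.of fun x y => ∑ a, ρ (a, x) (a, y)

/-- The reduced state on the first system, `ρ^A = Tr_E ρ`. -/
def reducedA {α ε : Type*} [Fintype ε] (ρ : Matrix (α × ε) (α × ε) ℂ) : Matrix α α ℂ :=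
  Matrix.of fun a b => ∑ x, ρ (a, x) (b, x)

/-- `H(A|ρ)`, the entropy of the first system. -/
def entropyA {α ε : Type*} [Fintype α] [DecidableEq α] [Fintype ε]
    (ρ : Matrix (α × ε) (α × ε) ℂ) : ℝ :=
  vonNeumannEntropy (reducedA ρ)

/-- The conditional entropy `H(A|E|ρ) = H(A,E|ρ) - H(E|ρ)`. -/
def condEntropy {α ε : Type*} [Fintype α] [DecidableEq α] [Fintype ε] [DecidableEq ε]
    (ρ : Matrix (α × ε) (α × ε) ℂ) : ℝ :=
  vonNeumannEntropy ρ - vonNeumannEntropy (reducedE ρ)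

/-- The mutual information
`I(A:E|ρ) = D(ρ ‖ ρ^A ⊗ ρ^E) = Tr ρ (log ρ - log (ρ^A ⊗ ρ^E))`. The support of a state `ρ` is
always contained in that of `ρ^A ⊗ ρ^E`, so that the relative entropy is finite and given by
this expression. -/
def mutualInfo {α ε : Type*} [Fintype α] [DecidableEq α] [Fintype ε] [DecidableEq ε]
    (ρ : Matrix (α × ε) (α × ε) ℂ) : ℝ :=
  (ρ * (matrixLog ρ - matrixLog (reducedA ρ ⊗ₖ reducedE ρ))).trace.re

/-- The i.i.d. state `ρ^{⊗ n}`, on the bipartite system with alphabet `α^n` and Eve's space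
`ε^{⊗ n}`. -/
def tensorPower {α ε : Type*} (ρ : Matrix (α × ε) (α × ε) ℂ) (n : ℕ) :
    Matrix ((Fin n → α) × (Fin n → ε)) ((Fin n → α) × (Fin n → ε)) ℂ :=
  Matrix.of fun x y => ∏ i, ρ (x.1 i, x.2 i) (y.1 i, y.2 i)

/-- The state of `f(A)` and `E`: for a classical-quantum state `∑ a, P(a) |a⟩⟨a| ⊗ ρ_a` this is
`∑ a, P(a) |f(a)⟩⟨f(a)| ⊗ ρ_a`. -/
def applyMap {α β ε : Type*} [Fintype α] [DecidableEq β] (f : α → β)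
    (ρ : Matrix (α × ε) (α × ε) ℂ) : Matrix (β × ε) (β × ε) ℂ :=
  ∑ a, Matrix.single (f a) (f a) (1 : ℂ) ⊗ₖ Matrix.of fun x y => ρ (a, x) (a, y)

/-- Sequences of maps `f_n : α^n → {1, …, ⌊e^{nR}⌋}`. -/
abbrev KeyMaps (α : Type*) (R : ℝ) : Type _ :=
  (n : ℕ) → (Fin n → α) → Fin ⌊Real.exp (n * R)⌋₊

/-- Asymptotic uniformity of the output: `H(f_n(A)|ρ^{⊗ n}) / (nR) → 1`. -/
def KeyMaps.AsymptoticallyUniform {α ε : Type*} [Fintype α] [DecidableEq α] [Fintype ε]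
    {R : ℝ} (f : KeyMaps α R) (ρ : Matrix (α × ε) (α × ε) ℂ) : Prop :=
  Tendsto (fun n : ℕ => entropyA (applyMap (f n) (tensorPower ρ n)) / (n * R)) atTop (𝓝 1)

/-- The equivocation rate: the supremum of `lim H(f_n(A)|E|ρ^{⊗ n}) / n` over the sequences with
asymptotically uniform output for which this limit exists (`-∞` if there are none). -/
def equivocationRate {α ε : Type*} [Fintype α] [DecidableEq α] [Fintype ε] [DecidableEq ε]
    (R : ℝ) (ρ : Matrix (α × ε) (α × ε) ℂ) : EReal :=
  sSup {x : EReal | ∃ (f : KeyMaps α R) (r : ℝ), x = (r : EReal) ∧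
    f.AsymptoticallyUniform ρ ∧
    Tendsto (fun n : ℕ => condEntropy (applyMap (f n) (tensorPower ρ n)) / n) atTop (𝓝 r)}

/-- The minimal leaked-information rate: the infimum of `lim I(f_n(A):E|ρ^{⊗ n}) / n` over the
sequences with asymptotically uniform output for which this limit exists (`+∞` if there are
none). -/
def leakedInfoRate {α ε : Type*} [Fintype α] [DecidableEq α] [Fintype ε] [DecidableEq ε]
    (R : ℝ) (ρ : Matrix (α × ε) (α × ε) ℂ) : EReal :=
  sInf {x : EReal | ∃ (f : KeyMaps α R) (r : ℝ), x = (r : EReal) ∧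
    f.AsymptoticallyUniform ρ ∧
    Tendsto (fun n : ℕ => mutualInfo (applyMap (f n) (tensorPower ρ n)) / n) atTop (𝓝 r)}

end

/-! Write Y_a = P(a) ρ_a, S = ∑ Y_a and h = H(A|E). Every entropy in the statement is an entropy of
the family Y, and a map f merely adds up the Y_a over its fibers.

Converse. Since 0 ≤ Y_a ≤ ∑_{f b = f a} Y_b, monotonicity of the matrix logarithm gives H(f(A)|E) ≤
nh (`familyCondEntropy_pushFamily_le`, with additivity `familyCondEntropy_powFamily`). Klein's
inequality gives H(f(A)|E) ≤ H(f(A)), and H(f(A)) ≤ nR by counting. As I = H(f(A)) - H(f(A)|E), both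
bounds on the rates follow.

Achievability. Choose f uniformly among all maps. Given the value f(a), the expected sum over its
fiber is Y_a + M⁻¹ ∑_{b ≠ a} Y_b, and operator concavity of the logarithm moves the expectation
inside (`average_neg_entropy_pushFamily_le`). The argument need not commute with S; the pinching
inequality replaces Y_a by its pinching to the blocks where S is constant, at the price of a factor
equal to the number of blocks. Everything then commutes, and a scalar estimate bounds the averaged
-H(f(A)|E) by the logarithm of a Rényi-type moment plus M^(-s) (`average_neg_familyCondEntropy_le`).
For n copies the blocks are type classes, polynomially many, the moment is an n-th power, and its
logarithmic derivative at s = 0 is -h; so the average of H(f(A)|E) is at least n(min(R, h) - δ) for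
large n.

The same estimate with a one-dimensional E shows that the output of a random map is almost uniform
when R ≤ H(A). Both deficits are nonnegative, so minimizing their sum yields one sequence that is
good for both (`exists_keyMaps_tendsto`). -/

/-! ### Unitary diagonalization and functional calculus -/

/-- `A = W diag(c) Wᴴ` with `W` unitary (possibly with a different index type for the
eigenvalues). -/
structure IsDiagonalizedBy {d k : Type*} [Fintype d] [DecidableEq d] [Fintype k] [DecidableEq k]
    (A : Matrix d d ℂ) (W : Matrix d k ℂ) (c : k → ℝ) : Prop where
  conjTranspose_mul_self : Wᴴ * W = 1
  mul_conjTranspose_self : W * Wᴴ = 1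
  eq_conj : A = W * Matrix.diagonal (fun i => (c i : ℂ)) * Wᴴ

namespace IsDiagonalizedBy

variable {d k : Type*} [Fintype d] [DecidableEq d] [Fintype k] [DecidableEq k]
  {A : Matrix d d ℂ} {W : Matrix d k ℂ} {c : k → ℝ}

theorem of_isHermitian (hA : A.IsHermitian) :
    IsDiagonalizedBy A (hA.eigenvectorUnitary : Matrix d d ℂ) hA.eigenvalues where
  conjTranspose_mul_self := Unitary.coe_star_mul_self hA.eigenvectorUnitary
  mul_conjTranspose_self := Unitary.coe_mul_star_self hA.eigenvectorUnitary
  eq_conj := by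
    conv_lhs => rw [hA.spectral_theorem, Unitary.conjStarAlgAut_apply]
    rfl

theorem mul_eq (h : IsDiagonalizedBy A W c) :
    A * W = W * Matrix.diagonal (fun i => (c i : ℂ)) := by
  rw [h.eq_conj, Matrix.mul_assoc, h.conjTranspose_mul_self, Matrix.mul_one]

theorem conj_eq (h : IsDiagonalizedBy A W c) :
    Wᴴ * A * W = Matrix.diagonal (fun i => (c i : ℂ)) := by
  rw [Matrix.mul_assoc, h.mul_eq, ← Matrix.mul_assoc, h.conjTranspose_mul_self, Matrix.one_mul]

theorem isHermitian (h : IsDiagonalizedBy A W c) : A.IsHermitian := by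
  rw [h.eq_conj]
  apply Matrix.isHermitian_mul_mul_conjTranspose
  ext i j
  by_cases hij : i = j
  · subst hij; simp
  · simp [hij, Ne.symm hij]

theorem nonneg (h : IsDiagonalizedBy A W c) (hA : A.PosSemidef) (i : k) : 0 ≤ c i := by
  have h1 := (hA.conjTranspose_mul_mul_same W).diag_nonneg (i := i)
  rw [h.conj_eq] at h1
  simpa using h1

/-- Independence of the chosen eigenbasis: `Wᴴ * U` intertwines the two diagonal matrices, so a
nonzero entry forces the two eigenvalues to agree, and then it also intertwines their images under
`f`. -/
theorem cfc_eq (h : IsDiagonalizedBy A W c) (f : ℝ → ℝ) :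
    cfc f A = W * Matrix.diagonal (fun i => (f (c i) : ℂ)) * Wᴴ := by
  have hA := h.isHermitian
  have hU := of_isHermitian hA
  set U := (hA.eigenvectorUnitary : Matrix d d ℂ) with hUdef
  have h1 : cfc f A = U * Matrix.diagonal (fun i => (f (hA.eigenvalues i) : ℂ)) * Uᴴ := by
    rw [hA.cfc_eq, Matrix.IsHermitian.cfc, Unitary.conjStarAlgAut_apply]
    rfl
  have key : Matrix.diagonal (fun i => (c i : ℂ)) * (Wᴴ * U)
      = (Wᴴ * U) * Matrix.diagonal (fun i => (hA.eigenvalues i : ℂ)) := by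
    calc _ = (Wᴴ * A * W) * (Wᴴ * U) := by rw [h.conj_eq]
      _ = Wᴴ * A * (W * Wᴴ) * U := by simp only [Matrix.mul_assoc]
      _ = Wᴴ * (A * U) := by rw [h.mul_conjTranspose_self, Matrix.mul_one, Matrix.mul_assoc]
      _ = _ := by rw [hU.mul_eq, Matrix.mul_assoc]
  have key2 : Matrix.diagonal (fun i => (f (c i) : ℂ)) * (Wᴴ * U)
      = (Wᴴ * U) * Matrix.diagonal (fun i => (f (hA.eigenvalues i) : ℂ)) := by
    ext i j
    have := congrFun (congrFun key i) j
    rw [Matrix.diagonal_mul, Matrix.mul_diagonal] at this ⊢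
    by_cases hz : (Wᴴ * U) i j = 0
    · simp [hz]
    · have hc : c i = hA.eigenvalues j := by
        rw [mul_comm] at this
        exact_mod_cast mul_left_cancel₀ hz this
      rw [hc, mul_comm]
  calc cfc f A = (W * Wᴴ) * (U * Matrix.diagonal (fun i => (f (hA.eigenvalues i) : ℂ)) * Uᴴ) := by
        rw [h.mul_conjTranspose_self, Matrix.one_mul, h1]
    _ = W * ((Wᴴ * U) * Matrix.diagonal (fun i => (f (hA.eigenvalues i) : ℂ))) * Uᴴ := by
        simp only [Matrix.mul_assoc]
    _ = W * Matrix.diagonal (fun i => (f (c i) : ℂ)) * Wᴴ * (U * Uᴴ) := by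
        rw [← key2]; simp only [Matrix.mul_assoc]
    _ = _ := by rw [hU.mul_conjTranspose_self, Matrix.mul_one]

theorem map (h : IsDiagonalizedBy A W c) (f : ℝ → ℝ) :
    IsDiagonalizedBy (cfc f A) W (fun i => f (c i)) :=
  ⟨h.conjTranspose_mul_self, h.mul_conjTranspose_self, h.cfc_eq f⟩

theorem trace_mul (h : IsDiagonalizedBy A W c) (B : Matrix d d ℂ) :
    (B * A).trace.re = ∑ i, c i * ((Wᴴ * B * W) i i).re := by
  have : (B * A).trace = (Wᴴ * B * W * Matrix.diagonal (fun i => (c i : ℂ))).trace := by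
    rw [h.eq_conj, ← Matrix.mul_assoc, Matrix.trace_mul_comm]
    simp only [Matrix.mul_assoc]
  rw [this, Matrix.trace, Complex.re_sum]
  refine Finset.sum_congr rfl fun i _ => ?_
  rw [Matrix.diag_apply, Matrix.mul_diagonal, Complex.re_mul_ofReal, mul_comm]

theorem trace_eq (h : IsDiagonalizedBy A W c) : A.trace.re = ∑ i, c i := by
  have := h.trace_mul 1
  rw [Matrix.one_mul, Matrix.mul_one, h.conjTranspose_mul_self] at this
  simpa using this

theorem trace_mul_matrixLog (h : IsDiagonalizedBy A W c) (B : Matrix d d ℂ) :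
    (B * matrixLog A).trace.re = ∑ i, Real.log (c i) * ((Wᴴ * B * W) i i).re :=
  (h.map Real.log).trace_mul B

theorem vonNeumannEntropy_eq (h : IsDiagonalizedBy A W c) :
    vonNeumannEntropy A = ∑ i, Real.negMulLog (c i) := by
  rw [vonNeumannEntropy, h.trace_mul_matrixLog, h.conj_eq, ← Finset.sum_neg_distrib]
  refine Finset.sum_congr rfl fun i _ => ?_
  simp [Real.negMulLog, mul_comm]

theorem conj {l : Type*} [Fintype l] [DecidableEq l] (h : IsDiagonalizedBy A W c)
    {V : Matrix d l ℂ} (hV : Vᴴ * V = 1)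
    (hV' : V * Vᴴ = 1) : IsDiagonalizedBy (Vᴴ * A * V) (Vᴴ * W) c where
  conjTranspose_mul_self := by
    rw [Matrix.conjTranspose_mul, Matrix.conjTranspose_conjTranspose, Matrix.mul_assoc,
      ← Matrix.mul_assoc V, hV', Matrix.one_mul, h.conjTranspose_mul_self]
  mul_conjTranspose_self := by
    rw [Matrix.conjTranspose_mul, Matrix.conjTranspose_conjTranspose, Matrix.mul_assoc,
      ← Matrix.mul_assoc W, h.mul_conjTranspose_self, Matrix.one_mul, hV]
  eq_conj := by
    rw [h.eq_conj, Matrix.conjTranspose_mul, Matrix.conjTranspose_conjTranspose]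
    simp only [Matrix.mul_assoc]

theorem smul_add_smul_one (h : IsDiagonalizedBy A W c) (t δ : ℝ) :
    IsDiagonalizedBy ((t : ℂ) • A + (δ : ℂ) • 1) W (fun i => t * c i + δ) where
  conjTranspose_mul_self := h.conjTranspose_mul_self
  mul_conjTranspose_self := h.mul_conjTranspose_self
  eq_conj := by
    have : Matrix.diagonal (fun i => ((t * c i + δ : ℝ) : ℂ))
        = (t : ℂ) • Matrix.diagonal (fun i => (c i : ℂ)) + (δ : ℂ) • (1 : Matrix k k ℂ) := by
      ext i j
      by_cases hij : i = j
      · subst hij; simp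
      · simp [hij]
    rw [this, Matrix.mul_add, Matrix.add_mul, Matrix.mul_smul, Matrix.smul_mul, ← h.eq_conj,
      Matrix.mul_smul, Matrix.smul_mul, Matrix.mul_one, h.mul_conjTranspose_self]

theorem add_smul_one (h : IsDiagonalizedBy A W c) (δ : ℝ) :
    IsDiagonalizedBy (A + (δ : ℂ) • 1) W (fun i => c i + δ) := by
  simpa using h.smul_add_smul_one 1 δ

/-- The diagonal entries of `A` in another basis are averages of its eigenvalues. -/
theorem conj_diag_eq {l : Type*} (h : IsDiagonalizedBy A W c) (V : Matrix d l ℂ) (i : l) :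
    ((Vᴴ * A * V) i i).re = ∑ j, c j * Complex.normSq ((Vᴴ * W) i j) := by
  have : Vᴴ * A * V = (Vᴴ * W) * Matrix.diagonal (fun i => (c i : ℂ)) * (Vᴴ * W)ᴴ := by
    rw [h.eq_conj, Matrix.conjTranspose_mul, Matrix.conjTranspose_conjTranspose]
    simp only [Matrix.mul_assoc]
  rw [this, Matrix.mul_apply, Complex.re_sum]
  refine Finset.sum_congr rfl fun j _ => ?_
  rw [Matrix.mul_diagonal, Matrix.conjTranspose_apply, mul_right_comm, Complex.star_def,
    Complex.mul_conj, ← Complex.ofReal_mul, Complex.ofReal_re, mul_comm]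

end IsDiagonalizedBy

section unitary

theorem sum_normSq_row {d k : Type*} [DecidableEq d] [Fintype k] {W : Matrix d k ℂ}
    (h : W * Wᴴ = 1) (i : d) :
    ∑ j, Complex.normSq (W i j) = 1 := by
  have := congrFun (congrFun h i) i
  rw [Matrix.mul_apply, Matrix.one_apply_eq] at this
  have h2 := congrArg Complex.re this
  rw [Complex.re_sum, Complex.one_re] at h2
  rw [← h2]
  refine Finset.sum_congr rfl fun j _ => ?_
  rw [Matrix.conjTranspose_apply, Complex.star_def, Complex.mul_conj, Complex.ofReal_re]

theorem sum_normSq_col {d k : Type*} [DecidableEq k] [Fintype d] {W : Matrix d k ℂ}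
    (h : Wᴴ * W = 1) (j : k) :
    ∑ i, Complex.normSq (W i j) = 1 := by
  rw [← sum_normSq_row (W := Wᴴ) (by simpa using h) j]
  simp [Complex.normSq_conj]

theorem unitary_overlap {d k l : Type*} [Fintype d] [DecidableEq d] [Fintype k] [DecidableEq k]
    [Fintype l] [DecidableEq l] {W : Matrix d k ℂ} {V : Matrix d l ℂ} (hW : Wᴴ * W = 1)
    (hW' : W * Wᴴ = 1)
    (hV : Vᴴ * V = 1) (hV' : V * Vᴴ = 1) :
    (Vᴴ * W)ᴴ * (Vᴴ * W) = 1 ∧ (Vᴴ * W) * (Vᴴ * W)ᴴ = 1 := by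
  rw [Matrix.conjTranspose_mul, Matrix.conjTranspose_conjTranspose]
  constructor
  · rw [Matrix.mul_assoc, ← Matrix.mul_assoc V, hV', Matrix.one_mul, hW]
  · rw [Matrix.mul_assoc, ← Matrix.mul_assoc W, hW', Matrix.one_mul, hV]

end unitary

/-! ### Traces of products of positive matrices -/

section traces

variable {d : Type*} [Fintype d] [DecidableEq d]

theorem Matrix.PosSemidef.trace_mul_re_nonneg {A B : Matrix d d ℂ} (hA : A.PosSemidef)
    (hB : B.PosSemidef) : 0 ≤ (A * B).trace.re := by
  have h := IsDiagonalizedBy.of_isHermitian hB.1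
  rw [h.trace_mul]
  refine Finset.sum_nonneg fun i _ => mul_nonneg (h.nonneg hB i) ?_
  exact (Complex.nonneg_iff.1 (hA.conjTranspose_mul_mul_same _).diag_nonneg).1

theorem trace_mul_re_mono {A B C : Matrix d d ℂ} (hA : A.PosSemidef) (hBC : (C - B).PosSemidef) :
    (A * B).trace.re ≤ (A * C).trace.re := by
  have := hA.trace_mul_re_nonneg hBC
  rw [Matrix.mul_sub, Matrix.trace_sub, Complex.sub_re] at this
  linarith

theorem vonNeumannEntropy_conj {k : Type*} [Fintype k] [DecidableEq k] {A : Matrix d d ℂ}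
    (hA : A.IsHermitian) {V : Matrix d k ℂ} (hV : Vᴴ * V = 1) (hV' : V * Vᴴ = 1) :
    vonNeumannEntropy (Vᴴ * A * V) = vonNeumannEntropy A := by
  have h := IsDiagonalizedBy.of_isHermitian hA
  rw [h.vonNeumannEntropy_eq, (h.conj hV hV').vonNeumannEntropy_eq]

end traces

/-! ### Operator monotonicity and concavity of the logarithm -/

section logOrder

open scoped MatrixOrder Matrix.Norms.L2Operator

variable {d : Type*} [Fintype d] [DecidableEq d]

/-- The matrix logarithm is operator monotone. -/
theorem matrixLog_mono {A B : Matrix d d ℂ} (hA : A.PosDef) (h : (B - A).PosSemidef) :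
    (matrixLog B - matrixLog A).PosSemidef :=
  Matrix.le_iff.1 (CFC.log_le_log (a := A) (b := B) (Matrix.le_iff.2 h)
    (Matrix.isStrictlyPositive_iff_posDef.2 hA))

/-- The matrix logarithm is operator concave. -/
theorem matrixLog_concave {ι : Type*} (t : Finset ι) (w : ι → ℝ) (A : ι → Matrix d d ℂ)
    (hw : ∀ i ∈ t, 0 ≤ w i) (hw1 : ∑ i ∈ t, w i = 1) (hA : ∀ i ∈ t, (A i).PosDef) :
    (matrixLog (∑ i ∈ t, w i • A i) - ∑ i ∈ t, w i • matrixLog (A i)).PosSemidef :=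
  Matrix.le_iff.1 (CFC.concaveOn_log.le_map_sum hw hw1
    fun i hi => Matrix.isStrictlyPositive_iff_posDef.2 (hA i hi))

end logOrder

/-! ### Logarithms on singular matrices; Klein's inequality -/

section regularization

variable {d k : Type*} [Fintype d] [DecidableEq d] [Fintype k] [DecidableEq k]

theorem posDef_smul_one {d : Type*} [DecidableEq d] {δ : ℝ} (hδ : 0 < δ) :
    ((δ : ℂ) • (1 : Matrix d d ℂ)).PosDef :=
  Matrix.PosDef.one.smul (by exact_mod_cast hδ)

theorem posDef_add_smul_one {d : Type*} [DecidableEq d] {A : Matrix d d ℂ} (hA : A.PosSemidef)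
    {δ : ℝ} (hδ : 0 < δ) : (A + (δ : ℂ) • 1).PosDef :=
  Matrix.PosDef.posSemidef_add hA (posDef_smul_one hδ)

/-- A positive semidefinite matrix dominated by `A` vanishes on the kernel of `A`. -/
theorem IsDiagonalizedBy.conj_diag_eq_zero {A B : Matrix d d ℂ} {W : Matrix d k ℂ} {c : k → ℝ}
    (h : IsDiagonalizedBy A W c) (hB : B.PosSemidef) (hAB : (A - B).PosSemidef) {i : k}
    (hi : c i = 0) : ((Wᴴ * B * W) i i).re = 0 := by
  have h1 := (Complex.nonneg_iff.1 ((hB.conjTranspose_mul_mul_same W).diag_nonneg (i := i))).1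
  have h2 := (Complex.nonneg_iff.1 ((hAB.conjTranspose_mul_mul_same W).diag_nonneg (i := i))).1
  rw [Matrix.mul_sub, Matrix.sub_mul, h.conj_eq] at h2
  simp [hi] at h2
  linarith

/-- The logarithm with value `0` on the kernel is a limit of regularized logarithms. -/
theorem tendsto_trace_mul_matrixLog {A B : Matrix d d ℂ} (hA : A.PosSemidef) (hB : B.PosSemidef)
    (hAB : (A - B).PosSemidef) :
    Tendsto (fun δ : ℝ => (B * matrixLog (A + (δ : ℂ) • 1)).trace.re) (𝓝[>] 0)
      (𝓝 (B * matrixLog A).trace.re) := by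
  have h := IsDiagonalizedBy.of_isHermitian hA.1
  rw [h.trace_mul_matrixLog]
  simp_rw [(h.add_smul_one _).trace_mul_matrixLog]
  refine tendsto_finsetSum _ fun i _ => ?_
  by_cases hi : hA.1.eigenvalues i = 0
  · simp only [h.conj_diag_eq_zero hB hAB hi, mul_zero]
    exact tendsto_const_nhds
  · refine Tendsto.mul_const _ ?_
    have : Tendsto (fun δ : ℝ => hA.1.eigenvalues i + δ) (𝓝[>] 0) (𝓝 (hA.1.eigenvalues i)) := by
      have h3 : Tendsto (fun δ : ℝ => hA.1.eigenvalues i + δ) (𝓝 0)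
          (𝓝 (hA.1.eigenvalues i + 0)) := tendsto_const_nhds.add tendsto_id
      rw [add_zero] at h3
      exact h3.mono_left nhdsWithin_le_nhds
    exact this.log hi

/-- Eigenvalue by eigenvalue; the kernel contributes zero to both sides. It buys the positive
definiteness that operator concavity requires. -/
theorem trace_mul_matrixLog_le_add {A : Matrix d d ℂ} (hA : A.PosSemidef) {δ : ℝ} (hδ : 0 < δ) :
    (A * matrixLog A).trace.re ≤ (A * matrixLog (A + (δ : ℂ) • 1)).trace.re := by
  have h := IsDiagonalizedBy.of_isHermitian hA.1
  rw [h.trace_mul_matrixLog, (h.add_smul_one _).trace_mul_matrixLog, h.conj_eq]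
  refine Finset.sum_le_sum fun i _ => ?_
  have h0 := h.nonneg hA i
  rw [Matrix.diagonal_apply_eq, Complex.ofReal_re]
  rcases h0.eq_or_lt with h1 | h1
  · simp [← h1]
  · exact mul_le_mul_of_nonneg_right (Real.log_le_log h1 (by linarith)) h0

/-- `Tr Y log Y ≤ Tr Y log A` if `0 ≤ Y ≤ A`. -/
theorem trace_mul_matrixLog_mono {A Y : Matrix d d ℂ} (hA : A.PosSemidef) (hY : Y.PosSemidef)
    (hAY : (A - Y).PosSemidef) :
    (Y * matrixLog Y).trace.re ≤ (Y * matrixLog A).trace.re := by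
  -- Monotonicity needs positive definite arguments, hence the regularization by δ. The limit on the
  -- right exists because Y ≤ A makes Y vanish on the kernel of A, where the logarithm diverges.
  refine le_of_tendsto_of_tendsto (tendsto_trace_mul_matrixLog hY hY (by simpa using .zero))
    (tendsto_trace_mul_matrixLog hA hY hAY) ?_
  filter_upwards [self_mem_nhdsWithin] with δ hδ
  exact trace_mul_re_mono hY (matrixLog_mono (posDef_add_smul_one hY hδ) (by simpa using hAY))

/-- Klein's inequality for `Y ≤ A`, with a scalar factor in the second argument. -/
theorem klein_inequality {A Y : Matrix d d ℂ} (hA : A.PosSemidef) (hY : Y.PosSemidef)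
    (hAY : (A - Y).PosSemidef) {q : ℝ} (hq : 0 < q) :
    Y.trace.re - q * A.trace.re ≤
      (Y * matrixLog Y).trace.re - Y.trace.re * Real.log q - (Y * matrixLog A).trace.re := by
  have hU := IsDiagonalizedBy.of_isHermitian hY.1
  have hV := IsDiagonalizedBy.of_isHermitian hA.1
  set U := (hY.1.eigenvectorUnitary : Matrix d d ℂ)
  set V := (hA.1.eigenvectorUnitary : Matrix d d ℂ)
  set p := hY.1.eigenvalues
  set l := hA.1.eigenvalues
  obtain ⟨o1, o2⟩ := unitary_overlap hU.conjTranspose_mul_self hU.mul_conjTranspose_self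
    hV.conjTranspose_mul_self hV.mul_conjTranspose_self
  -- The squared overlaps of the two eigenbases are doubly stochastic, so all four traces become
  -- sums of scalars against `O`.
  set O := fun i j => Complex.normSq ((Vᴴ * U) i j) with hO
  have r1 : ∀ i, ∑ j, O i j = 1 := sum_normSq_row o2
  have r2 : ∀ j, ∑ i, O i j = 1 := sum_normSq_col o1
  have e1 : Y.trace.re = ∑ i, ∑ j, p j * O i j := by
    rw [hU.trace_eq, Finset.sum_comm]
    simp_rw [← Finset.mul_sum, r2, mul_one]
  have e2 : A.trace.re = ∑ i, ∑ j, l i * O i j := by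
    rw [hV.trace_eq]
    simp_rw [← Finset.mul_sum, r1, mul_one]
  have e3 : (Y * matrixLog Y).trace.re = ∑ i, ∑ j, p j * Real.log (p j) * O i j := by
    rw [hU.trace_mul_matrixLog, hU.conj_eq, Finset.sum_comm]
    simp_rw [← Finset.mul_sum, r2, mul_one]
    refine Finset.sum_congr rfl fun i _ => ?_
    rw [Matrix.diagonal_apply_eq, Complex.ofReal_re, mul_comm]
  have e4 : (Y * matrixLog A).trace.re = ∑ i, ∑ j, Real.log (l i) * (p j * O i j) := by
    rw [hV.trace_mul_matrixLog]
    simp_rw [← Finset.mul_sum]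
    refine Finset.sum_congr rfl fun i _ => ?_
    rw [hU.conj_diag_eq V i]
  rw [e1, e2, e3, e4, Finset.mul_sum, Finset.sum_mul, ← Finset.sum_sub_distrib,
    ← Finset.sum_sub_distrib, ← Finset.sum_sub_distrib]
  refine Finset.sum_le_sum fun i _ => ?_
  rw [Finset.mul_sum, Finset.sum_mul, ← Finset.sum_sub_distrib, ← Finset.sum_sub_distrib,
    ← Finset.sum_sub_distrib]
  refine Finset.sum_le_sum fun j _ => ?_
  have hp : 0 ≤ p j := hU.nonneg hY j
  have hl : 0 ≤ l i := hV.nonneg hA i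
  have hOnn : 0 ≤ O i j := Complex.normSq_nonneg _
  rcases hp.eq_or_lt with h1 | h1
  · rw [← h1]
    have := mul_nonneg hq.le (mul_nonneg hl hOnn)
    simpa using this
  -- Where A has eigenvalue 0, Y ≤ A kills the overlap with every eigenvector of Y of positive
  -- eigenvalue, so the default value log 0 = 0 does no harm.
  rcases hl.eq_or_lt with h2 | h2
  · have h3 := hV.conj_diag_eq_zero hY hAY h2.symm
    rw [hU.conj_diag_eq V i, Finset.sum_eq_zero_iff_of_nonneg
      (fun j _ => mul_nonneg (hU.nonneg hY j) (Complex.normSq_nonneg _))] at h3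
    have h4 : O i j = 0 := by
      rcases mul_eq_zero.1 (h3 j (Finset.mem_univ _)) with h | h
      · exact absurd h h1.ne'
      · exact h
    simp [h4]
  -- This is log x ≤ x - 1 at x = q l / p, multiplied by p.
  · have key : p j - q * l i ≤ p j * Real.log (p j) - p j * Real.log q - p j * Real.log (l i) := by
      have h5 := Real.log_le_sub_one_of_pos (div_pos (mul_pos hq h2) h1)
      rw [Real.log_div (mul_pos hq h2).ne' h1.ne', Real.log_mul hq.ne' h2.ne'] at h5
      have h6 := mul_le_mul_of_nonneg_left h5 h1.le
      have h7 : p j * (q * l i / p j - 1) = q * l i - p j := by field_simp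
      rw [h7] at h6
      nlinarith
    nlinarith [mul_le_mul_of_nonneg_right key hOnn]

end regularization

/-! ### Conditional entropy of families and data processing -/

section families

/-- The conditional entropy of the classical index given the quantum system, for a family of
unnormalized states. -/
noncomputable def familyCondEntropy {α d : Type*} [Fintype α] [Fintype d] [DecidableEq d]
    (Y : α → Matrix d d ℂ) : ℝ :=
  ∑ a, vonNeumannEntropy (Y a) - vonNeumannEntropy (∑ a, Y a)

/-- The family of states of `f(A)`. -/
def pushFamily {α β d : Type*} [Fintype α] [DecidableEq β] (f : α → β) (Y : α → Matrix d d ℂ)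
    (b : β) : Matrix d d ℂ :=
  ∑ a with f a = b, Y a

theorem Matrix.posSemidef_sum_sub {α d : Type*} {Y : α → Matrix d d ℂ} {s : Finset α}
    (hY : ∀ a, (Y a).PosSemidef) {a : α} (ha : a ∈ s) : (∑ b ∈ s, Y b - Y a).PosSemidef := by
  classical
  rw [← Finset.add_sum_erase s Y ha, add_sub_cancel_left]
  exact Matrix.posSemidef_sum _ fun b _ => hY b

theorem pushFamily_posSemidef {α β d : Type*} [Fintype α] [DecidableEq β] {f : α → β}
    {Y : α → Matrix d d ℂ} (hY : ∀ a, (Y a).PosSemidef) (b : β) :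
    (pushFamily f Y b).PosSemidef :=
  Matrix.posSemidef_sum _ fun a _ => hY a

theorem sum_pushFamily {α β d : Type*} [Fintype α] [Fintype β] [DecidableEq β] {f : α → β}
    {Y : α → Matrix d d ℂ} : ∑ b, pushFamily f Y b = ∑ a, Y a :=
  Finset.sum_fiberwise _ _ _

theorem sum_trace_pushFamily_mul {α β d : Type*} [Fintype α] [Fintype d] [Fintype β]
    [DecidableEq β] {f : α → β} {Y : α → Matrix d d ℂ} (L : β → Matrix d d ℂ) :
    ∑ b, (pushFamily f Y b * L b).trace.re = ∑ a, (Y a * L (f a)).trace.re := by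
  rw [← Finset.sum_fiberwise (s := Finset.univ) (g := f)
    (f := fun a => (Y a * L (f a)).trace.re)]
  refine Finset.sum_congr rfl fun b _ => ?_
  rw [pushFamily, Finset.sum_mul, Matrix.trace_sum, Complex.re_sum]
  refine Finset.sum_congr rfl fun a ha => ?_
  rw [(Finset.mem_filter.1 ha).2]

variable {α d : Type*} [Fintype α] [Fintype d] [DecidableEq d] {Y : α → Matrix d d ℂ}

/-- Processing the classical part does not increase the conditional entropy. -/
theorem familyCondEntropy_pushFamily_le {β : Type*} [Fintype β] [DecidableEq β] {f : α → β}
    (hY : ∀ a, (Y a).PosSemidef) :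
    familyCondEntropy (pushFamily f Y) ≤ familyCondEntropy Y := by
  rw [familyCondEntropy, familyCondEntropy, sum_pushFamily]
  simp only [vonNeumannEntropy, Finset.sum_neg_distrib]
  rw [sum_trace_pushFamily_mul]
  have : ∑ a, (Y a * matrixLog (Y a)).trace.re
      ≤ ∑ a, (Y a * matrixLog (pushFamily f Y (f a))).trace.re :=
    Finset.sum_le_sum fun a _ => trace_mul_matrixLog_mono (pushFamily_posSemidef hY _) (hY a)
      (Matrix.posSemidef_sum_sub hY (by simp))
  linarith

/-- Data processing for the constant map, whose output has conditional entropy zero. -/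
theorem familyCondEntropy_nonneg (hY : ∀ a, (Y a).PosSemidef) : 0 ≤ familyCondEntropy Y := by
  have := familyCondEntropy_pushFamily_le (f := fun _ : α => ()) hY
  rwa [familyCondEntropy, sum_pushFamily, Fintype.sum_unique, pushFamily, Finset.filter_true_of_mem
    (by simp), sub_self] at this

/-- The conditional entropy is at most the entropy of the classical index. -/
theorem familyCondEntropy_le (hY : ∀ a, (Y a).PosSemidef) (htr : (∑ a, Y a).trace.re = 1) :
    familyCondEntropy Y ≤ ∑ a, Real.negMulLog (Y a).trace.re := by
  have hS : (∑ a, Y a).PosSemidef := Matrix.posSemidef_sum _ fun a _ => hY a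
  have key : ∀ a, (Y a * matrixLog (∑ a, Y a)).trace.re - Real.negMulLog (Y a).trace.re
      ≤ (Y a * matrixLog (Y a)).trace.re := by
    intro a
    have h0 : 0 ≤ (Y a).trace.re := (Complex.nonneg_iff.1 (hY a).trace_nonneg).1
    rcases h0.eq_or_lt with h1 | h1
    · have : Y a = 0 := by
        rw [← (hY a).trace_eq_zero_iff]
        exact Complex.ext h1.symm (Complex.nonneg_iff.1 (hY a).trace_nonneg).2.symm
      simp [this]
    -- With q = Tr Y_a and Tr S = 1, the left side of Klein's inequality vanishes.
    · have := klein_inequality hS (hY a) (Matrix.posSemidef_sum_sub hY (Finset.mem_univ a)) h1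
      rw [htr, mul_one, sub_self] at this
      rw [Real.negMulLog]
      linarith
  have h2 := Finset.sum_le_sum fun a (_ : a ∈ Finset.univ) => key a
  rw [Finset.sum_sub_distrib, ← Complex.re_sum, ← Matrix.trace_sum, ← Finset.sum_mul] at h2
  simp only [familyCondEntropy, vonNeumannEntropy, Finset.sum_neg_distrib]
  linarith

end families

/-! ### Pinching and block-adapted eigenbases -/

section pinching

/-- The pinching of a matrix to the blocks given by the fibers of `τ`. -/
def pinch {d T : Type*} [DecidableEq T] (τ : d → T) (A : Matrix d d ℂ) : Matrix d d ℂ :=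
  Matrix.of fun x y => if τ x = τ y then A x y else 0

/-- Let B = |T|·1 - J with J the all-ones matrix. From J² = |T| J one gets BᴴB = |T| B, so B is a
nonnegative multiple of a Gram matrix. -/
theorem posSemidef_card_smul_one_sub {T : Type*} [Fintype T] [DecidableEq T] :
    (Matrix.of fun i j : T => (Fintype.card T : ℂ) * (if i = j then 1 else 0) - 1).PosSemidef := by
  set B : Matrix T T ℂ := Matrix.of fun i j : T =>
    (Fintype.card T : ℂ) * (if i = j then 1 else 0) - 1 with hB
  rcases isEmpty_or_nonempty T with hT | hT
  · convert Matrix.PosSemidef.zero (n := T) (R := ℂ)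
    ext i; exact isEmptyElim i
  have hv : (Fintype.card T : ℂ) ≠ 0 := by exact_mod_cast Fintype.card_ne_zero
  have h1 : Bᴴ * B = (Fintype.card T : ℂ) • B := by
    ext i j
    rw [Matrix.mul_apply]
    simp only [hB, Matrix.conjTranspose_apply, Matrix.of_apply, Matrix.smul_apply, star_sub,
      star_mul', smul_eq_mul, star_one]
    have : ∀ x : T, (star (Fintype.card T : ℂ) * star (if x = i then (1 : ℂ) else 0) - 1) *
        ((Fintype.card T : ℂ) * (if x = j then 1 else 0) - 1) =
        (Fintype.card T : ℂ) ^ 2 * (if x = i then (if x = j then 1 else 0) else 0)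
        - (Fintype.card T : ℂ) * (if x = i then 1 else 0)
        - (Fintype.card T : ℂ) * (if x = j then 1 else 0) + 1 := by
      intro x
      split_ifs <;> simp <;> ring
    simp_rw [this]
    simp only [Finset.sum_add_distrib, Finset.sum_sub_distrib, ← Finset.mul_sum]
    simp only [Finset.sum_ite_eq', Finset.mem_univ, if_true, Finset.sum_const, Finset.card_univ,
      nsmul_eq_mul]
    ring
  have h2 : B = (Fintype.card T : ℂ)⁻¹ • (Bᴴ * B) := by
    rw [h1, smul_smul, inv_mul_cancel₀ hv, one_smul]
  rw [h2]
  refine (Matrix.posSemidef_conjTranspose_mul_self B).smul ?_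
  rw [Complex.nonneg_iff]
  have : (Fintype.card T : ℂ)⁻¹ = (((Fintype.card T : ℝ)⁻¹ : ℝ) : ℂ) := by push_cast; rfl
  rw [this]
  exact ⟨by rw [Complex.ofReal_re]; positivity, by simp⟩

/-- The pinching inequality. -/
theorem pinching_inequality {d T : Type*} [Fintype d] [Fintype T] [DecidableEq T] (τ : d → T)
    {A : Matrix d d ℂ} (hA : A.PosSemidef) :
    ((Fintype.card T : ℂ) • pinch τ A - A).PosSemidef := by
  -- Schur product theorem: the difference is the Hadamard product of `A` with |T|·1 - J pulled back
  -- along `τ`.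
  have h := hA.hadamard ((posSemidef_card_smul_one_sub (T := T)).submatrix τ)
  refine cast (congrArg _ ?_) h
  ext x y
  simp only [pinch, Matrix.sub_apply, Matrix.smul_apply, Matrix.of_apply, Matrix.hadamard_apply,
    Matrix.submatrix_apply, smul_eq_mul]
  split_ifs <;> ring

theorem IsDiagonalizedBy.of_submatrix_equiv {d k l : Type*} [Fintype d] [DecidableEq d] [Fintype k]
    [DecidableEq k] [Fintype l] [DecidableEq l] {A : Matrix d d ℂ} (e : l ≃ d) {W : Matrix l k ℂ}
    {c : k → ℝ} (h : IsDiagonalizedBy (A.submatrix e e) W c) :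
    IsDiagonalizedBy A (W.submatrix e.symm id) c where
  conjTranspose_mul_self := by
    rw [Matrix.conjTranspose_submatrix, Matrix.submatrix_mul_equiv, h.conjTranspose_mul_self,
      Matrix.submatrix_id_id]
  mul_conjTranspose_self := by
    rw [Matrix.conjTranspose_submatrix, ← Matrix.submatrix_mul _ _ _ _ _ Function.bijective_id,
      h.mul_conjTranspose_self, Matrix.submatrix_one_equiv]
  eq_conj := by
    have h2 : A = (A.submatrix e e).submatrix e.symm e.symm := by ext; simp
    rw [h2, h.eq_conj, Matrix.conjTranspose_submatrix,
      Matrix.submatrix_mul _ _ _ _ _ Function.bijective_id,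
      Matrix.submatrix_mul _ _ _ _ _ Function.bijective_id, Matrix.submatrix_id_id]

/-- A block diagonal matrix is diagonalized within its blocks. -/
theorem exists_isDiagonalizedBy_pinch {d T : Type*} [Fintype d] [DecidableEq d] [Fintype T]
    [DecidableEq T] (τ : d → T) {A : Matrix d d ℂ} (hA : A.IsHermitian) :
    ∃ (W : Matrix d (Σ t, {y // τ y = t}) ℂ) (c : (Σ t, {y // τ y = t}) → ℝ),
      IsDiagonalizedBy (pinch τ A) W c ∧ ∀ y i, τ y ≠ i.1 → W y i = 0 := by
  let B : (t : T) → Matrix {y // τ y = t} {y // τ y = t} ℂ := fun t =>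
    A.submatrix Subtype.val Subtype.val
  have hB : ∀ t, (B t).IsHermitian := fun t => hA.submatrix _
  have hD := fun t => IsDiagonalizedBy.of_isHermitian (hB t)
  set U := fun t => ((hB t).eigenvectorUnitary : Matrix {y // τ y = t} {y // τ y = t} ℂ)
  set e := Equiv.sigmaFiberEquiv τ
  have h1 : (pinch τ A).submatrix e e = Matrix.blockDiagonal' B := by
    ext ⟨t, x, hx⟩ ⟨t', y, hy⟩
    simp only [pinch, Matrix.submatrix_apply, Matrix.of_apply]
    by_cases h : t = t'
    · subst h
      rw [Matrix.blockDiagonal'_apply_eq, if_pos]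
      · rfl
      · exact hx.trans hy.symm
    · rw [Matrix.blockDiagonal'_apply_ne _ _ _ h, if_neg]
      intro h'
      exact h (hx.symm.trans (h'.trans hy))
  have h2 : IsDiagonalizedBy ((pinch τ A).submatrix e e) (Matrix.blockDiagonal' U)
      (fun i => (hB i.1).eigenvalues i.2) := by
    refine ⟨?_, ?_, ?_⟩
    · rw [Matrix.blockDiagonal'_conjTranspose, ← Matrix.blockDiagonal'_mul,
        ← Matrix.blockDiagonal'_one]
      exact congrArg _ (funext fun t => (hD t).conjTranspose_mul_self)
    · rw [Matrix.blockDiagonal'_conjTranspose, ← Matrix.blockDiagonal'_mul,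
        ← Matrix.blockDiagonal'_one]
      exact congrArg _ (funext fun t => (hD t).mul_conjTranspose_self)
    · have h3 := Matrix.blockDiagonal'_diagonal (m' := fun t => {y // τ y = t})
        (fun t i => ((hB t).eigenvalues i : ℂ))
      rw [h1, Matrix.blockDiagonal'_conjTranspose, ← h3,
        ← Matrix.blockDiagonal'_mul, ← Matrix.blockDiagonal'_mul]
      exact congrArg _ (funext fun t => (hD t).eq_conj)
  refine ⟨_, _, h2.of_submatrix_equiv, fun y i hyi => ?_⟩
  exact Matrix.blockDiagonal'_apply_ne U (e.symm y).2 i.2 hyi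

section support

variable {d T k : Type*} [Fintype d] {τ : d → T} {W : Matrix d k ℂ} {r : k → T}

/-- A function of `τ` is scalar on each block and thus commutes with a basis adapted to the blocks.
So one basis serves both the pinched state and a marginal that is constant on blocks. -/
theorem isDiagonalizedBy_diagonal_of_support [DecidableEq d] [Fintype k] [DecidableEq k]
    (h1 : Wᴴ * W = 1) (h2 : W * Wᴴ = 1)
    (hW : ∀ y i, τ y ≠ r i → W y i = 0) (g : T → ℝ) :
    IsDiagonalizedBy (Matrix.diagonal fun y => (g (τ y) : ℂ)) W (fun i => g (r i)) := by
  refine ⟨h1, h2, ?_⟩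
  have : W * Matrix.diagonal (fun i => (g (r i) : ℂ))
      = Matrix.diagonal (fun y => (g (τ y) : ℂ)) * W := by
    ext y i
    rw [Matrix.mul_diagonal, Matrix.diagonal_mul]
    by_cases h : τ y = r i
    · rw [h, mul_comm]
    · rw [hW y i h]; simp
  rw [this, Matrix.mul_assoc, h2, Matrix.mul_one]

/-- Each column of `W` lives in one block, so the entries removed by pinching never meet a diagonal
coefficient. Eigenvalues of the pinched matrix are therefore diagonal coefficients of the original
one. -/
theorem conj_pinch_diag_eq [DecidableEq T] (hW : ∀ y i, τ y ≠ r i → W y i = 0)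
    (A : Matrix d d ℂ) (i : k) : (Wᴴ * pinch τ A * W) i i = (Wᴴ * A * W) i i := by
  simp only [Matrix.mul_apply, Finset.sum_mul]
  refine Finset.sum_congr rfl fun y _ => Finset.sum_congr rfl fun x _ => ?_
  simp only [pinch, Matrix.of_apply, Matrix.conjTranspose_apply]
  split_ifs with h
  · rfl
  · by_cases hx : τ x = r i
    · have hy : τ y ≠ r i := fun hy => h (hx.trans hy.symm)
      rw [hW y i hy]; simp
    · rw [hW x i hx]; simp

end support

theorem isDiagonalizedBy_diagonal {d : Type*} [Fintype d] [DecidableEq d] (g : d → ℝ) :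
    IsDiagonalizedBy (Matrix.diagonal fun y => (g y : ℂ)) 1 g := by
  refine ⟨by simp, by simp, by simp⟩

/-- The same diagonal entry of UᴴDU, with D the diagonal matrix of `g`, expanded once in the basis
`W` and once in the standard basis. -/
theorem IsDiagonalizedBy.sum_mul_normSq {d k l : Type*} [Fintype d] [DecidableEq d] [Fintype k]
    [DecidableEq k] {W : Matrix d k ℂ} {c : k → ℝ} {g : d → ℝ}
    (h : IsDiagonalizedBy (Matrix.diagonal fun y => (g y : ℂ)) W c) (U : Matrix d l ℂ) (j : l) :
    ∑ i, c i * Complex.normSq ((Wᴴ * U) i j) = ∑ y, g y * Complex.normSq (U y j) := by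
  have h1 := h.conj_diag_eq U j
  rw [(isDiagonalizedBy_diagonal g).conj_diag_eq U j] at h1
  have h3 : ∀ i, (Wᴴ * U) i j = star ((Uᴴ * W) j i) := fun i => by
    rw [← Matrix.conjTranspose_apply, Matrix.conjTranspose_mul, Matrix.conjTranspose_conjTranspose]
  simp_rw [h3, Complex.star_def, Complex.normSq_conj]
  rw [← h1]
  simp [Complex.normSq_conj]

end pinching

/-! ### Random hashing -/

section hashing

variable {α d : Type*} [Fintype α] [DecidableEq α] [Fintype d] [DecidableEq d]
  {Y : α → Matrix d d ℂ}

/-- Collisions have probability 1/M: adding c to the value at `a` is a bijection from the maps with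
f b = f a to those with f a - f b = c, in the cyclic group `Fin M`. -/
theorem card_mul_card_collision {M : ℕ} [NeZero M] {a b : α} (hab : b ≠ a) :
    M * (Finset.univ.filter fun f : α → Fin M => f b = f a).card
      = Fintype.card (α → Fin M) := by
  have h1 : ∀ c : Fin M, (Finset.univ.filter fun f : α → Fin M => f b = f a).card
      = (Finset.univ.filter fun f : α → Fin M => f a - f b = c).card := by
    intro c
    refine Finset.card_equiv (Equiv.addRight (Pi.single a c)) fun f => ?_
    simp [hab, add_sub_right_comm, sub_eq_zero, eq_comm]
  have h2 : ∑ c : Fin M, (Finset.univ.filter fun f : α → Fin M => f a - f b = c).card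
      = Fintype.card (α → Fin M) := by
    rw [← Finset.card_eq_sum_card_fiberwise (fun _ _ => Finset.mem_coe.2 (Finset.mem_univ _)),
      Finset.card_univ]
  rw [← h2, ← Finset.sum_congr rfl fun c _ => h1 c]
  simp

/-- The letter `a` always lies in its own fiber, and every other letter joins it with probability
1/M. -/
theorem average_pushFamily {α d : Type*} [Fintype α] [DecidableEq α] {Y : α → Matrix d d ℂ}
    {M : ℕ} [NeZero M] (a : α) :
    ∑ f : α → Fin M, (Fintype.card (α → Fin M) : ℝ)⁻¹ • pushFamily f Y (f a)
      = Y a + (M : ℝ)⁻¹ • ∑ b ∈ Finset.univ.erase a, Y b := by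
  have hN : (Fintype.card (α → Fin M) : ℝ) ≠ 0 := by exact_mod_cast Fintype.card_ne_zero
  have hM : (M : ℝ) ≠ 0 := by exact_mod_cast NeZero.ne M
  rw [← Finset.smul_sum]
  simp only [pushFamily, Finset.sum_filter]
  rw [Finset.sum_comm, ← Finset.add_sum_erase _ _ (Finset.mem_univ a), smul_add]
  congr 1
  · simp only [if_true, Finset.sum_const, Finset.card_univ]
    rw [← Nat.cast_smul_eq_nsmul ℝ, smul_smul, inv_mul_cancel₀ hN, one_smul]
  · rw [Finset.smul_sum, Finset.smul_sum]
    refine Finset.sum_congr rfl fun b hb => ?_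
    rw [← Finset.sum_filter, Finset.sum_const, ← Nat.cast_smul_eq_nsmul ℝ, smul_smul]
    congr 1
    have := card_mul_card_collision (M := M) (Finset.ne_of_mem_erase hb)
    rw [← this]
    have h3 : ((Finset.univ.filter fun f : α → Fin M => f b = f a).card : ℝ) ≠ 0 := by
      intro h0
      rw [Nat.cast_eq_zero] at h0
      rw [h0, mul_zero] at this
      exact hN (by rw [← this]; simp)
    push_cast
    field_simp

/-- Random hashing: the averaged negative entropy is controlled by operator concavity of the
logarithm. -/
theorem average_neg_entropy_pushFamily_le (hY : ∀ a, (Y a).PosSemidef) {M : ℕ} [NeZero M]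
    {X : α → Matrix d d ℂ} (hX : ∀ a, (X a - Y a).PosSemidef) {δ : ℝ} (hδ : 0 < δ) :
    (Fintype.card (α → Fin M) : ℝ)⁻¹ *
        ∑ f : α → Fin M, -∑ m, vonNeumannEntropy (pushFamily f Y m) ≤
      ∑ a, (Y a * matrixLog
        (X a + (((M : ℝ)⁻¹ : ℝ) : ℂ) • ∑ b, Y b + (δ : ℂ) • 1)).trace.re := by
  set w : ℝ := (Fintype.card (α → Fin M) : ℝ)⁻¹ with hw
  have hN : (Fintype.card (α → Fin M) : ℝ) ≠ 0 := by exact_mod_cast Fintype.card_ne_zero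
  have hw1 : ∑ _f : α → Fin M, w = 1 := by
    rw [Finset.sum_const, Finset.card_univ, nsmul_eq_mul, hw, mul_inv_cancel₀ hN]
  have hw0 : 0 ≤ w := by positivity
  have step1 : ∀ f : α → Fin M, -∑ m, vonNeumannEntropy (pushFamily f Y m) ≤
      ∑ a, (Y a * matrixLog (pushFamily f Y (f a) + (δ : ℂ) • 1)).trace.re := by
    intro f
    rw [← Finset.sum_neg_distrib,
      ← sum_trace_pushFamily_mul (fun b => matrixLog (pushFamily f Y b + (δ : ℂ) • 1))]
    refine Finset.sum_le_sum fun m _ => ?_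
    rw [vonNeumannEntropy, neg_neg]
    exact trace_mul_matrixLog_le_add (pushFamily_posSemidef hY m) hδ
  calc w * ∑ f : α → Fin M, -∑ m, vonNeumannEntropy (pushFamily f Y m)
      ≤ w * ∑ f : α → Fin M,
          ∑ a, (Y a * matrixLog (pushFamily f Y (f a) + (δ : ℂ) • 1)).trace.re :=
        mul_le_mul_of_nonneg_left (Finset.sum_le_sum fun f _ => step1 f) hw0
    _ = ∑ a, (Y a * ∑ f : α → Fin M,
          w • matrixLog (pushFamily f Y (f a) + (δ : ℂ) • 1)).trace.re := by
        rw [Finset.sum_comm, Finset.mul_sum]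
        refine Finset.sum_congr rfl fun a _ => ?_
        rw [Finset.mul_sum, Finset.mul_sum, Matrix.trace_sum, Complex.re_sum]
        refine Finset.sum_congr rfl fun f _ => ?_
        rw [Matrix.mul_smul, Matrix.trace_smul, Complex.smul_re, smul_eq_mul]
    _ ≤ _ := by
        refine Finset.sum_le_sum fun a _ => ?_
        have hpd : ∀ f : α → Fin M, (pushFamily f Y (f a) + (δ : ℂ) • 1).PosDef := fun f =>
          posDef_add_smul_one (pushFamily_posSemidef hY _) hδ
        have hconc := matrixLog_concave Finset.univ (fun _ => w)
          (fun f : α → Fin M => pushFamily f Y (f a) + (δ : ℂ) • 1) (fun _ _ => hw0) hw1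
          (fun f _ => hpd f)
        refine (trace_mul_re_mono (hY a) hconc).trans (trace_mul_re_mono (hY a) ?_)
        have hsum : ∑ f : α → Fin M, w • (pushFamily f Y (f a) + (δ : ℂ) • 1)
            = Y a + (M : ℝ)⁻¹ • ∑ b ∈ Finset.univ.erase a, Y b + (δ : ℂ) • 1 := by
          simp only [smul_add, Finset.sum_add_distrib]
          rw [average_pushFamily, ← Finset.sum_smul, hw1, one_smul]
        -- The two arguments of the logarithm differ by X_a - Y_a plus M⁻¹ Y_a, the latter added
        -- when the sum over b ≠ a is completed to all b.
        have hps : ((M : ℝ)⁻¹ • Y a).PosSemidef := (hY a).smul (by positivity)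
        rw [hsum]
        refine matrixLog_mono (posDef_add_smul_one ((hY a).add
          ((Matrix.posSemidef_sum _ fun b _ => hY b).smul (by positivity))) hδ) ?_
        convert (hX a).add hps using 1
        rw [Complex.coe_smul, ← Finset.add_sum_erase _ Y (Finset.mem_univ a), smul_add]
        abel

end hashing

/-! ### One-shot privacy amplification -/

section oneShot

/-- Subadditivity of the power s ≤ 1, in logarithmic form; it is what turns a log-likelihood ratio
into a moment of order s. -/
theorem log_add_le_rpow {x y s : ℝ} (hx : 0 ≤ x) (hy : 0 < y) (hs : 0 < s) (hs1 : s ≤ 1) :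
    Real.log (x + y) ≤ 1 / s * Real.log (x ^ s + y ^ s) := by
  have h1 : (x + y) ^ s ≤ x ^ s + y ^ s := Real.rpow_add_le_add_rpow hx hy.le hs.le hs1
  have h2 := Real.log_le_log (Real.rpow_pos_of_pos (by linarith) s) h1
  rw [Real.log_rpow (by linarith)] at h2
  rw [one_div, inv_mul_eq_div, le_div_iff₀ hs]
  linarith

theorem mul_div_rpow {m g s : ℝ} (hm : 0 ≤ m) (hg : 0 ≤ g) (hs : 0 < s) :
    m * (m / g) ^ s = m ^ (1 + s) * g ^ (-s) := by
  rw [Real.div_rpow hm hg, Real.rpow_neg hg, Real.rpow_add_of_nonneg hm zero_le_one hs.le,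
    Real.rpow_one, div_eq_mul_inv, mul_assoc]

/-- A Rényi-type bound for the expected log-likelihood ratio. -/
theorem sum_mul_log_ratio_le {ι : Type*} [Fintype ι] {m g : ι → ℝ} (hm : ∀ i, 0 ≤ m i)
    (hg : ∀ i, 0 ≤ g i) (hmg : ∀ i, g i = 0 → m i = 0) (hsum : ∑ i, m i = 1) {v t s : ℝ}
    (hv : 1 ≤ v) (ht : 0 < t) (hs : 0 < s) (hs1 : s ≤ 1) :
    ∑ i, m i * (Real.log (v * m i + t * g i) - Real.log (g i)) ≤
      Real.log v + 1 / s * Real.log (∑ i, m i ^ (1 + s) * g i ^ (-s) + t ^ s) := by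
  set c := ∑ i, m i ^ (1 + s) * g i ^ (-s) + t ^ s with hc
  have hts : 0 < t ^ s := Real.rpow_pos_of_pos ht s
  have hc0 : 0 < c := by
    have : 0 ≤ ∑ i, m i ^ (1 + s) * g i ^ (-s) := Finset.sum_nonneg fun i _ =>
      mul_nonneg (Real.rpow_nonneg (hm i) _) (Real.rpow_nonneg (hg i) _)
    linarith
  -- Jensen through a tangent: log z ≤ log c + z/c - 1 with z = (m/g)^s + t^s, and `c` is exactly
  -- the mean of z under `m`, so the correction averages to zero.
  have key : ∀ i, m i * (Real.log (v * m i + t * g i) - Real.log (g i)) ≤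
      m i * (Real.log v + 1 / s * (Real.log c - 1))
        + 1 / s * ((m i ^ (1 + s) * g i ^ (-s) + m i * t ^ s) / c) := by
    intro i
    rw [← mul_div_rpow (hm i) (hg i) hs]
    rcases (hm i).eq_or_lt with h | h
    · rw [← h]; simp
    have hgi : 0 < g i := (hg i).lt_of_ne fun h0 => h.ne' (hmg i h0.symm)
    set r := m i / g i with hr
    have hr0 : 0 ≤ r := by positivity
    have h1 : Real.log (v * m i + t * g i) - Real.log (g i) ≤ Real.log v + Real.log (r + t) := by
      rw [← Real.log_div (by positivity) hgi.ne', ← Real.log_mul (by positivity) (by positivity)]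
      refine Real.log_le_log (by positivity) ?_
      have : (v * m i + t * g i) / g i = v * r + t := by rw [hr]; field_simp
      rw [this, mul_add]
      nlinarith
    have h2 := log_add_le_rpow hr0 ht hs hs1
    have hz : 0 < r ^ s + t ^ s := add_pos_of_nonneg_of_pos (Real.rpow_nonneg hr0 s) hts
    have h3 : Real.log (r ^ s + t ^ s) ≤ Real.log c + ((r ^ s + t ^ s) / c - 1) := by
      have := Real.log_le_sub_one_of_pos (div_pos hz hc0)
      rw [Real.log_div hz.ne' hc0.ne'] at this
      linarith
    have h4 : 1 / s * Real.log (r ^ s + t ^ s)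
        ≤ 1 / s * (Real.log c + ((r ^ s + t ^ s) / c - 1)) :=
      mul_le_mul_of_nonneg_left h3 (by positivity)
    calc m i * (Real.log (v * m i + t * g i) - Real.log (g i))
        ≤ m i * (Real.log v + 1 / s * (Real.log c + ((r ^ s + t ^ s) / c - 1))) :=
          mul_le_mul_of_nonneg_left (by linarith) h.le
      _ = _ := by ring
  refine (Finset.sum_le_sum fun i _ => key i).trans (le_of_eq ?_)
  rw [Finset.sum_add_distrib, ← Finset.sum_mul, hsum, ← Finset.mul_sum, ← Finset.sum_div,
    Finset.sum_add_distrib, ← Finset.sum_mul, hsum, one_mul, one_mul, ← hc, div_self hc0.ne']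
  ring

theorem pushFamily_conj {α β d l : Type*} [Fintype α] [Fintype d] [DecidableEq β]
    {Y : α → Matrix d d ℂ} (f : α → β) (V : Matrix d l ℂ) (b : β) :
    pushFamily f (fun a => Vᴴ * Y a * V) b = Vᴴ * pushFamily f Y b * V := by
  simp only [pushFamily, Matrix.mul_sum, Matrix.sum_mul]

theorem familyCondEntropy_conj {α d l : Type*} [Fintype α] [Fintype d] [DecidableEq d]
    [Fintype l] [DecidableEq l] {Y : α → Matrix d d ℂ}
    (hY : ∀ a, (Y a).PosSemidef) {V : Matrix d l ℂ} (hV : Vᴴ * V = 1) (hV' : V * Vᴴ = 1) :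
    familyCondEntropy (fun a => Vᴴ * Y a * V) = familyCondEntropy Y := by
  rw [familyCondEntropy, familyCondEntropy, ← Matrix.sum_mul, ← Matrix.mul_sum,
    vonNeumannEntropy_conj (Matrix.posSemidef_sum _ fun a _ => hY a).1 hV hV']
  simp_rw [fun a => vonNeumannEntropy_conj (hY a).1 hV hV']

variable {α d κ T : Type*} [Fintype α] [DecidableEq α] [Fintype d] [DecidableEq d]
  [Fintype κ] [DecidableEq κ] [Fintype T] [DecidableEq T] {Y : α → Matrix d d ℂ}

/-- Privacy amplification by random hashing, for a family whose marginal is diagonal and constant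
on the fibers of `τ`. -/
theorem average_neg_familyCondEntropy_le_of_diagonal (hY : ∀ a, (Y a).PosSemidef)
    (htr : (∑ a, Y a).trace.re = 1) {τ : d → T} {g : T → ℝ}
    (hS : ∑ a, Y a = Matrix.diagonal fun y => (g (τ y) : ℂ)) {U : α → Matrix d κ ℂ}
    {p : α → κ → ℝ} (hU : ∀ a, IsDiagonalizedBy (Y a) (U a) (p a)) {M : ℕ} [NeZero M] {s : ℝ}
    (hs : 0 < s) (hs1 : s ≤ 1) :
    (Fintype.card (α → Fin M) : ℝ)⁻¹ * ∑ f : α → Fin M, -familyCondEntropy (pushFamily f Y) ≤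
      Real.log (Fintype.card T) + 1 / s * Real.log (∑ a, ∑ k, ∑ y,
        p a k ^ (1 + s) * g (τ y) ^ (-s) * Complex.normSq (U a y k) + ((M : ℝ)⁻¹) ^ s) := by
  classical
  have hd : Nonempty d := by
    by_contra h
    rw [not_nonempty_iff] at h
    simp [Matrix.trace] at htr
  have hT : Nonempty T := hd.map τ
  have hM : (0 : ℝ) < (M : ℝ)⁻¹ := inv_pos.2 (by exact_mod_cast NeZero.pos M)
  have hSps : (∑ a, Y a).PosSemidef := Matrix.posSemidef_sum _ fun a _ => hY a
  -- The eigenbasis of each pinched `Y a`, adapted to the blocks. In it the marginal is diagonal as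
  -- well, and the problem becomes one about the scalars `μ` and `g`.
  choose W μ hW hsupp using fun a => exists_isDiagonalizedBy_pinch τ (hY a).1
  have hdiag : ∀ (h : T → ℝ) (a : α), IsDiagonalizedBy
      (Matrix.diagonal fun y => (h (τ y) : ℂ)) (W a) (fun i => h i.1) := fun h a =>
    isDiagonalizedBy_diagonal_of_support (hW a).conjTranspose_mul_self
      (hW a).mul_conjTranspose_self (hsupp a) h
  have hμ : ∀ a i, μ a i = (((W a)ᴴ * Y a * W a) i i).re := by
    intro a i
    rw [← conj_pinch_diag_eq (hsupp a), (hW a).conj_eq, Matrix.diagonal_apply_eq,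
      Complex.ofReal_re]
  have hμ0 : ∀ a i, 0 ≤ μ a i := fun a i => by
    rw [hμ]
    exact (Complex.nonneg_iff.1 (((hY a).conjTranspose_mul_mul_same (W a)).diag_nonneg
      (i := i))).1
  set v : ℝ := (Fintype.card T : ℝ) with hv
  have hv1 : 1 ≤ v := by rw [hv]; exact_mod_cast Nat.succ_le_of_lt (Fintype.card_pos (α := T))
  have hS' : ∀ a, IsDiagonalizedBy (∑ a, Y a) (W a) (fun i => g i.1) := fun a => by
    rw [hS]; exact hdiag g a
  have hg0 : ∀ (a : α) (i : Σ t, {y // τ y = t}), 0 ≤ g i.1 := fun a i => (hS' a).nonneg hSps i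
  have hμg : ∀ a i, g i.1 = 0 → μ a i = 0 := fun a i h => by
    rw [hμ]
    exact (hS' a).conj_diag_eq_zero (hY a)
      (Matrix.posSemidef_sum_sub hY (Finset.mem_univ a)) h
  have hμsum : ∑ ai : α × (Σ t, {y // τ y = t}), μ ai.1 ai.2 = 1 := by
    rw [Fintype.sum_prod_type, ← htr, Matrix.trace_sum, Complex.re_sum]
    refine Finset.sum_congr rfl fun a _ => ?_
    have := ((hdiag (fun _ => 1) a)).trace_mul (Y a)
    simp only [Complex.ofReal_one, one_mul] at this
    rw [Matrix.diagonal_one, Matrix.mul_one] at this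
    rw [this]
    exact Finset.sum_congr rfl fun i _ => hμ a i
  -- Random hashing with X_a = |T| times the pinched Y_a, which dominates Y_a by the pinching
  -- inequality.
  have step1 : ∀ δ : ℝ, 0 < δ → (Fintype.card (α → Fin M) : ℝ)⁻¹ *
        ∑ f : α → Fin M, -∑ m, vonNeumannEntropy (pushFamily f Y m) ≤
      ∑ ai : α × (Σ t, {y // τ y = t}),
        Real.log (v * μ ai.1 ai.2 + (M : ℝ)⁻¹ * g ai.2.1 + δ) * μ ai.1 ai.2 := by
    intro δ hδ
    refine (average_neg_entropy_pushFamily_le hY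
      (X := fun a => (v : ℂ) • pinch τ (Y a)) (fun a => ?_) hδ).trans (le_of_eq ?_)
    · have := pinching_inequality τ (hY a)
      rwa [hv, Complex.ofReal_natCast]
    · rw [Fintype.sum_prod_type]
      refine Finset.sum_congr rfl fun a _ => ?_
      have hdec : IsDiagonalizedBy ((v : ℂ) • pinch τ (Y a)
          + (((M : ℝ)⁻¹ : ℝ) : ℂ) • ∑ b, Y b + (δ : ℂ) • 1) (W a)
          (fun i => v * μ a i + (M : ℝ)⁻¹ * g i.1 + δ) := by
        refine ⟨(hW a).conjTranspose_mul_self, (hW a).mul_conjTranspose_self, ?_⟩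
        have : Matrix.diagonal (fun i => ((v * μ a i + (M : ℝ)⁻¹ * g i.1 + δ : ℝ) : ℂ))
            = (v : ℂ) • Matrix.diagonal (fun i => (μ a i : ℂ))
              + (((M : ℝ)⁻¹ : ℝ) : ℂ) • Matrix.diagonal
                (fun i : (Σ t, {y // τ y = t}) => (g i.1 : ℂ)) + (δ : ℂ) • 1 := by
          ext i j
          by_cases hij : i = j
          · subst hij; simp
          · simp [hij]
        rw [this]
        simp only [Matrix.mul_add, Matrix.add_mul, Matrix.mul_smul, Matrix.smul_mul,
          Matrix.mul_one]
        rw [← (hW a).eq_conj, ← (hS' a).eq_conj, (hW a).mul_conjTranspose_self]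
      rw [hdec.trace_mul_matrixLog]
      exact Finset.sum_congr rfl fun i _ => by rw [hμ]
  have step2 : (Fintype.card (α → Fin M) : ℝ)⁻¹ *
        ∑ f : α → Fin M, -∑ m, vonNeumannEntropy (pushFamily f Y m) ≤
      ∑ ai : α × (Σ t, {y // τ y = t}),
        Real.log (v * μ ai.1 ai.2 + (M : ℝ)⁻¹ * g ai.2.1) * μ ai.1 ai.2 := by
    have hlim : Tendsto (fun δ : ℝ => ∑ ai : α × (Σ t, {y // τ y = t}),
        Real.log (v * μ ai.1 ai.2 + (M : ℝ)⁻¹ * g ai.2.1 + δ) * μ ai.1 ai.2) (𝓝[>] 0)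
        (𝓝 (∑ ai : α × (Σ t, {y // τ y = t}),
        Real.log (v * μ ai.1 ai.2 + (M : ℝ)⁻¹ * g ai.2.1) * μ ai.1 ai.2)) := by
      refine tendsto_finsetSum _ fun ai _ => ?_
      rcases (hμ0 ai.1 ai.2).eq_or_lt with h | h
      · simp only [← h, mul_zero]
        exact tendsto_const_nhds
      · refine Tendsto.mul_const _ (Tendsto.log ?_ ?_)
        · have h3 : Tendsto (fun δ : ℝ => v * μ ai.1 ai.2 + (M : ℝ)⁻¹ * g ai.2.1 + δ) (𝓝 0)
              (𝓝 (v * μ ai.1 ai.2 + (M : ℝ)⁻¹ * g ai.2.1 + 0)) :=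
            tendsto_const_nhds.add tendsto_id
          rw [add_zero] at h3
          exact h3.mono_left nhdsWithin_le_nhds
        · have := hg0 ai.1 ai.2
          positivity
    refine ge_of_tendsto hlim ?_
    filter_upwards [self_mem_nhdsWithin] with δ hδ using step1 δ hδ
  have hent : vonNeumannEntropy (∑ a, Y a)
      = -∑ ai : α × (Σ t, {y // τ y = t}), Real.log (g ai.2.1) * μ ai.1 ai.2 := by
    rw [vonNeumannEntropy, Finset.sum_mul, Matrix.trace_sum, Complex.re_sum,
      Fintype.sum_prod_type]
    congr 1
    refine Finset.sum_congr rfl fun a _ => ?_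
    rw [(hS' a).trace_mul_matrixLog]
    exact Finset.sum_congr rfl fun i _ => by rw [hμ]
  have hN : (Fintype.card (α → Fin M) : ℝ) ≠ 0 := by exact_mod_cast Fintype.card_ne_zero
  have step3 : (Fintype.card (α → Fin M) : ℝ)⁻¹ *
        ∑ f : α → Fin M, -familyCondEntropy (pushFamily f Y) ≤
      ∑ ai : α × (Σ t, {y // τ y = t}), μ ai.1 ai.2 *
        (Real.log (v * μ ai.1 ai.2 + (M : ℝ)⁻¹ * g ai.2.1) - Real.log (g ai.2.1)) := by
    have h1 : ∀ f : α → Fin M, -familyCondEntropy (pushFamily f Y)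
        = -∑ m, vonNeumannEntropy (pushFamily f Y m) + vonNeumannEntropy (∑ a, Y a) := by
      intro f
      rw [familyCondEntropy, sum_pushFamily]; ring
    simp_rw [h1, Finset.sum_add_distrib, Finset.sum_const, Finset.card_univ, nsmul_eq_mul, mul_add]
    rw [← mul_assoc, inv_mul_cancel₀ hN, one_mul, hent]
    simp_rw [mul_sub]
    rw [Finset.sum_sub_distrib]
    simp_rw [mul_comm (μ _ _)]
    linarith
  have step4 := sum_mul_log_ratio_le (ι := α × (Σ t, {y // τ y = t}))
    (m := fun ai => μ ai.1 ai.2) (g := fun ai => g ai.2.1) (fun ai => hμ0 _ _)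
    (fun ai => hg0 ai.1 _) (fun ai => hμg _ _) hμsum hv1 hM hs hs1
  refine (step3.trans step4).trans ?_
  have hphi : ∑ ai : α × (Σ t, {y // τ y = t}), μ ai.1 ai.2 ^ (1 + s) * g ai.2.1 ^ (-s) ≤
      ∑ a, ∑ k, ∑ y, p a k ^ (1 + s) * g (τ y) ^ (-s) * Complex.normSq (U a y k) := by
    rw [Fintype.sum_prod_type]
    refine Finset.sum_le_sum fun a _ => ?_
    obtain ⟨o1, o2⟩ := unitary_overlap (hU a).conjTranspose_mul_self
      (hU a).mul_conjTranspose_self (hW a).conjTranspose_mul_self (hW a).mul_conjTranspose_self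
    -- Each `μ a i` is an average of the eigenvalues `p a k` with the overlaps as weights; convexity
    -- of x^(1+s) applies.
    have h1 : ∀ i, μ a i ^ (1 + s)
        ≤ ∑ k, Complex.normSq (((W a)ᴴ * U a) i k) * p a k ^ (1 + s) := by
      intro i
      rw [hμ, (hU a).conj_diag_eq (W a) i]
      simp_rw [mul_comm (p a _) (Complex.normSq _)]
      exact Real.rpow_arith_mean_le_arith_mean_rpow _ _ _ (fun k _ => Complex.normSq_nonneg _)
        (sum_normSq_row o2 i) (fun k _ => (hU a).nonneg (hY a) k) (by linarith)
    calc ∑ i, μ a i ^ (1 + s) * g i.1 ^ (-s)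
        ≤ ∑ i : (Σ t, {y // τ y = t}),
          (∑ k, Complex.normSq (((W a)ᴴ * U a) i k) * p a k ^ (1 + s)) * g i.1 ^ (-s) :=
          Finset.sum_le_sum fun i _ => mul_le_mul_of_nonneg_right (h1 i)
            (Real.rpow_nonneg (hg0 a i) _)
      _ = ∑ k, p a k ^ (1 + s) * ∑ i : (Σ t, {y // τ y = t}),
            g i.1 ^ (-s) * Complex.normSq (((W a)ᴴ * U a) i k) := by
          simp_rw [Finset.sum_mul, Finset.mul_sum]
          rw [Finset.sum_comm]
          exact Finset.sum_congr rfl fun k _ => Finset.sum_congr rfl fun i _ => by ring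
      _ = _ := by
          refine Finset.sum_congr rfl fun k _ => ?_
          rw [(hdiag (fun t => g t ^ (-s)) a).sum_mul_normSq (U a) k, Finset.mul_sum]
          exact Finset.sum_congr rfl fun y _ => by ring
  have hpos : 0 < ∑ ai : α × (Σ t, {y // τ y = t}), μ ai.1 ai.2 ^ (1 + s) * g ai.2.1 ^ (-s)
      + ((M : ℝ)⁻¹) ^ s := by
    have : 0 ≤ ∑ ai : α × (Σ t, {y // τ y = t}), μ ai.1 ai.2 ^ (1 + s) * g ai.2.1 ^ (-s) :=
      Finset.sum_nonneg fun ai _ => mul_nonneg (Real.rpow_nonneg (hμ0 _ _) _)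
        (Real.rpow_nonneg (hg0 ai.1 _) _)
    have := Real.rpow_pos_of_pos hM s
    linarith
  have := Real.log_le_log hpos (add_le_add_left hphi (((M : ℝ)⁻¹) ^ s))
  gcongr

/-- Privacy amplification by random hashing. -/
theorem average_neg_familyCondEntropy_le {l : Type*} [Fintype l] [DecidableEq l]
    (hY : ∀ a, (Y a).PosSemidef)
    (htr : (∑ a, Y a).trace.re = 1) {τ : l → T} {g : T → ℝ} {V : Matrix d l ℂ}
    (hS : IsDiagonalizedBy (∑ a, Y a) V (fun y => g (τ y))) {U : α → Matrix d κ ℂ}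
    {p : α → κ → ℝ} (hU : ∀ a, IsDiagonalizedBy (Y a) (U a) (p a)) {M : ℕ} [NeZero M] {s : ℝ}
    (hs : 0 < s) (hs1 : s ≤ 1) :
    (Fintype.card (α → Fin M) : ℝ)⁻¹ * ∑ f : α → Fin M, -familyCondEntropy (pushFamily f Y) ≤
      Real.log (Fintype.card T) + 1 / s * Real.log (∑ a, ∑ k, ∑ y,
        p a k ^ (1 + s) * g (τ y) ^ (-s) * Complex.normSq ((Vᴴ * U a) y k)
          + ((M : ℝ)⁻¹) ^ s) := by
  have hV := hS.conjTranspose_mul_self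
  have hV' := hS.mul_conjTranspose_self
  have hsum : ∑ a, Vᴴ * Y a * V = Vᴴ * (∑ a, Y a) * V := by
    rw [Matrix.mul_sum, Matrix.sum_mul]
  -- Rotating all states by `V` makes the marginal diagonal and changes no entropy.
  have h := average_neg_familyCondEntropy_le_of_diagonal (Y := fun a => Vᴴ * Y a * V) (M := M)
    (fun a => (hY a).conjTranspose_mul_mul_same V)
    (by rw [hsum, Matrix.trace_mul_comm, ← Matrix.mul_assoc, hV', Matrix.one_mul, htr])
    (τ := τ) (g := g) (by rw [hsum, hS.conj_eq]) (fun a => (hU a).conj hV hV') hs hs1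
  refine le_trans (le_of_eq ?_) h
  congr 1
  refine Finset.sum_congr rfl fun f _ => ?_
  rw [funext (pushFamily_conj (Y := Y) f V),
    familyCondEntropy_conj (pushFamily_posSemidef hY) hV hV']

end oneShot

/-! ### Tensor powers and types -/

section tensor

/-- The tensor product of a finite sequence of matrices. -/
def tensorPi {d k : Type*} {n : ℕ} (A : Fin n → Matrix d k ℂ) :
    Matrix (Fin n → d) (Fin n → k) ℂ :=
  Matrix.of fun x y => ∏ i, A i (x i) (y i)

theorem tensorPi_mul {d k l : Type*} [Fintype k] {n : ℕ} (A : Fin n → Matrix d k ℂ)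
    (B : Fin n → Matrix k l ℂ) : tensorPi A * tensorPi B = tensorPi fun i => A i * B i := by
  ext x y
  simp only [tensorPi, Matrix.mul_apply, Matrix.of_apply, ← Finset.prod_mul_distrib]
  rw [Finset.prod_univ_sum, Fintype.piFinset_univ]

theorem tensorPi_conjTranspose {d k : Type*} {n : ℕ} (A : Fin n → Matrix d k ℂ) :
    (tensorPi A)ᴴ = tensorPi fun i => (A i)ᴴ := by
  ext x y
  simp [tensorPi, Matrix.conjTranspose_apply]

theorem tensorPi_diagonal {d : Type*} [DecidableEq d] {n : ℕ} (c : Fin n → d → ℂ) :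
    tensorPi (fun i => Matrix.diagonal (c i)) = Matrix.diagonal fun x => ∏ i, c i (x i) := by
  ext x y
  simp only [tensorPi, Matrix.of_apply]
  by_cases h : x = y
  · subst h; simp
  · rw [Matrix.diagonal_apply_ne _ h]
    obtain ⟨i, hi⟩ := Function.ne_iff.1 h
    exact Finset.prod_eq_zero (Finset.mem_univ i) (Matrix.diagonal_apply_ne _ hi)

theorem tensorPi_one {d : Type*} [DecidableEq d] {n : ℕ} :
    tensorPi (fun _ : Fin n => (1 : Matrix d d ℂ)) = 1 := by
  simp only [← Matrix.diagonal_one]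
  rw [tensorPi_diagonal]
  simp

theorem sum_tensorPi {α d : Type*} [Fintype α] {n : ℕ} (Y : α → Matrix d d ℂ) :
    ∑ x : Fin n → α, tensorPi (fun i => Y (x i)) = tensorPi fun _ => ∑ a, Y a := by
  ext x y
  simp only [tensorPi, Matrix.sum_apply, Matrix.of_apply]
  rw [Finset.prod_univ_sum, Fintype.piFinset_univ]

theorem IsDiagonalizedBy.tensorPi {d k : Type*} [Fintype d] [DecidableEq d] [Fintype k]
    [DecidableEq k] {n : ℕ} {A : Fin n → Matrix d d ℂ} {W : Fin n → Matrix d k ℂ}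
    {c : Fin n → k → ℝ} (h : ∀ i, IsDiagonalizedBy (A i) (W i) (c i)) :
    IsDiagonalizedBy (tensorPi A) (tensorPi W) (fun x => ∏ i, c i (x i)) where
  conjTranspose_mul_self := by
    rw [tensorPi_conjTranspose, tensorPi_mul]
    simp_rw [(h _).conjTranspose_mul_self]
    exact tensorPi_one
  mul_conjTranspose_self := by
    rw [tensorPi_conjTranspose, tensorPi_mul]
    simp_rw [(h _).mul_conjTranspose_self]
    exact tensorPi_one
  eq_conj := by
    simp_rw [Complex.ofReal_prod]
    rw [← tensorPi_diagonal fun i x => (c i x : ℂ), tensorPi_conjTranspose, tensorPi_mul,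
      tensorPi_mul]
    exact congrArg _ (funext fun i => (h i).eq_conj)

theorem IsDiagonalizedBy.posSemidef {d k : Type*} [Fintype d] [DecidableEq d] [Fintype k]
    [DecidableEq k] {A : Matrix d d ℂ} {W : Matrix d k ℂ} {c : k → ℝ}
    (h : IsDiagonalizedBy A W c) (hc : ∀ i, 0 ≤ c i) : A.PosSemidef := by
  rw [h.eq_conj]
  refine (Matrix.PosSemidef.diagonal fun i => ?_).mul_mul_conjTranspose_same W
  simpa using hc i

theorem tensorPi_posSemidef {d : Type*} [Fintype d] [DecidableEq d] {n : ℕ}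
    {A : Fin n → Matrix d d ℂ} (hA : ∀ i, (A i).PosSemidef) : (tensorPi A).PosSemidef :=
  (IsDiagonalizedBy.tensorPi fun i => IsDiagonalizedBy.of_isHermitian (hA i).1).posSemidef
    fun x => Finset.prod_nonneg fun i _ => (hA i).eigenvalues_nonneg (x i)

theorem tensorPi_trace {d : Type*} [Fintype d] {n : ℕ} (A : Fin n → Matrix d d ℂ) :
    (tensorPi A).trace = ∏ i, (A i).trace := by
  simp only [Matrix.trace, Matrix.diag_apply, tensorPi, Matrix.of_apply]
  rw [Finset.prod_univ_sum, Fintype.piFinset_univ]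

/-- Additivity of the Shannon entropy for product distributions. -/
theorem sum_negMulLog_prod {Z : Type*} [Fintype Z] {F : Z → ℝ} (hF : ∑ z, F z = 1) (n : ℕ) :
    ∑ z : Fin n → Z, Real.negMulLog (∏ i, F (z i)) = n * ∑ z, Real.negMulLog (F z) := by
  induction n with
  | zero => simp
  | succ n ih =>
    rw [← (Fin.consEquiv fun _ : Fin (n + 1) => Z).sum_comp, Fintype.sum_prod_type]
    have hprod : ∑ z : Fin n → Z, ∏ i, F (z i) = 1 := by rw [← Fintype.sum_pow, hF, one_pow]
    have h1 : ∀ (z : Z) (w : Fin n → Z),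
        Real.negMulLog (∏ i, F ((Fin.consEquiv fun _ : Fin (n + 1) => Z) (z, w) i))
          = (∏ i, F (w i)) * Real.negMulLog (F z) + F z * Real.negMulLog (∏ i, F (w i)) := by
      intro z w
      rw [Fin.prod_univ_succ, ← Real.negMulLog_mul]
      simp [Fin.consEquiv]
    simp_rw [h1, Finset.sum_add_distrib, ← Finset.sum_mul, ← Finset.mul_sum, hprod, ih, one_mul]
    rw [← Finset.sum_mul, hF]
    push_cast
    ring

theorem sum_arrow_prod {α κ : Type*} [Fintype α] [Fintype κ] {n : ℕ}
    (G : (Fin n → α) → (Fin n → κ) → ℝ) :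
    ∑ x, ∑ k, G x k = ∑ z : Fin n → α × κ, G (fun i => (z i).1) (fun i => (z i).2) := by
  rw [← Fintype.sum_prod_type',
    ← (Equiv.arrowProdEquivProdArrow (Fin n) (fun _ => α) (fun _ => κ)).sum_comp]
  rfl

/-- The i.i.d. extension of a family of unnormalized states. -/
def powFamily {α d : Type*} (Y : α → Matrix d d ℂ) (n : ℕ) (x : Fin n → α) :
    Matrix (Fin n → d) (Fin n → d) ℂ :=
  tensorPi fun i => Y (x i)

variable {α d : Type*} [Fintype α] [Fintype d] [DecidableEq d] {Y : α → Matrix d d ℂ}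

theorem sum_powFamily_trace {α d : Type*} [Fintype α] [Fintype d] {Y : α → Matrix d d ℂ}
    (htr : (∑ a, Y a).trace = 1) (n : ℕ) : (∑ x, powFamily Y n x).trace = 1 := by
  simp only [powFamily]
  rw [sum_tensorPi, tensorPi_trace, htr, Finset.prod_const_one]

/-- The eigenvalues of all the product states together form a product distribution on pairs (letter,
eigenvector index), as do those of the marginal, so additivity of Shannon entropy covers both terms.
-/
theorem familyCondEntropy_powFamily (hY : ∀ a, (Y a).PosSemidef) (htr : (∑ a, Y a).trace = 1)
    (n : ℕ) : familyCondEntropy (powFamily Y n) = n * familyCondEntropy Y := by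
  have hU := fun a => IsDiagonalizedBy.of_isHermitian (hY a).1
  have hV := IsDiagonalizedBy.of_isHermitian (Matrix.posSemidef_sum Finset.univ fun a _ => hY a).1
  rw [familyCondEntropy, familyCondEntropy]
  simp only [powFamily]
  rw [sum_tensorPi, (IsDiagonalizedBy.tensorPi fun _ : Fin n => hV).vonNeumannEntropy_eq,
    hV.vonNeumannEntropy_eq]
  simp_rw [fun x : Fin n → α =>
    (IsDiagonalizedBy.tensorPi fun i => hU (x i)).vonNeumannEntropy_eq,
    fun a => (hU a).vonNeumannEntropy_eq]
  rw [sum_arrow_prod (fun (x : Fin n → α) (k : Fin n → d) =>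
      Real.negMulLog (∏ i, (hY (x i)).1.eigenvalues (k i))),
    sum_negMulLog_prod (F := fun z : α × d => (hY z.1).1.eigenvalues z.2),
    sum_negMulLog_prod, Fintype.sum_prod_type]
  · ring
  · rw [← hV.trace_eq, htr, Complex.one_re]
  · rw [Fintype.sum_prod_type]
    simp_rw [← fun a => (hU a).trace_eq]
    rw [← Complex.re_sum, ← Matrix.trace_sum, htr, Complex.one_re]

/-- The type of a sequence: the number of occurrences of each letter. -/
def letterCount {d : Type*} [DecidableEq d] {n : ℕ} (y : Fin n → d) (e : d) : Fin (n + 1) :=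
  ⟨(Finset.univ.filter fun i => y i = e).card,
    Nat.lt_succ_of_le ((Finset.card_le_univ _).trans (by simp))⟩

/-- An eigenvalue of the n-fold marginal depends only on the type of its index, so (n+1)^|d|
pinching blocks are enough. -/
theorem prod_pow_letterCount {n : ℕ} (g : d → ℝ) (y : Fin n → d) :
    ∏ e, g e ^ (letterCount y e : ℕ) = ∏ i, g (y i) := by
  rw [← Finset.prod_fiberwise' Finset.univ y g]
  exact Finset.prod_congr rfl fun e _ => by rw [Finset.prod_const]; rfl

end tensor

/-! ### The Rényi-type moment near s = 0 -/

section renyi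

variable {α d κ l : Type*} [Fintype α] [Fintype d] [Fintype κ] [Fintype l]

/-- The exponential moment of the log-likelihood ratio of two Nussbaum–Szkoła distributions. -/
noncomputable def renyiMoment (p : α → κ → ℝ) (g : l → ℝ) (V : Matrix d l ℂ)
    (U : α → Matrix d κ ℂ) (s : ℝ) : ℝ :=
  ∑ a, ∑ k, ∑ y, p a k ^ (1 + s) * g y ^ (-s) * Complex.normSq ((Vᴴ * U a) y k)

theorem renyiMoment_pow {p : α → κ → ℝ} {g : l → ℝ} (hp : ∀ a k, 0 ≤ p a k) (hg : ∀ y, 0 ≤ g y)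
    (V : Matrix d l ℂ) (U : α → Matrix d κ ℂ) (s : ℝ) (n : ℕ) :
    renyiMoment (fun (x : Fin n → α) k => ∏ i, p (x i) (k i)) (fun y => ∏ i, g (y i))
      (tensorPi fun _ => V) (fun x => tensorPi fun i => U (x i)) s
      = renyiMoment p g V U s ^ n := by
  simp only [renyiMoment]
  rw [Fintype.sum_pow]
  refine Finset.sum_congr rfl fun x _ => ?_
  rw [Finset.prod_univ_sum, Fintype.piFinset_univ]
  refine Finset.sum_congr rfl fun k _ => ?_
  rw [Finset.prod_univ_sum, Fintype.piFinset_univ]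
  refine Finset.sum_congr rfl fun y _ => ?_
  rw [tensorPi_conjTranspose, tensorPi_mul, Finset.prod_mul_distrib, Finset.prod_mul_distrib,
    Real.finsetProd_rpow _ _ (fun i _ => hp _ _), Real.finsetProd_rpow _ _ (fun i _ => hg _)]
  simp only [tensorPi, Matrix.of_apply, map_prod]

variable [DecidableEq d] [DecidableEq κ] [DecidableEq l] {Y : α → Matrix d d ℂ}

/-- As a function of s the moment is 1 at 0 with derivative -H(A|E). For small s > 0 it is thus at
most 1 - s(H(A|E) - δ), and 1 + x ≤ exp x finishes. -/
theorem exists_renyiMoment_le (hY : ∀ a, (Y a).PosSemidef) (htr : (∑ a, Y a).trace = 1)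
    {V : Matrix d l ℂ} {g : l → ℝ} (hV : IsDiagonalizedBy (∑ a, Y a) V g) {U : α → Matrix d κ ℂ}
    {p : α → κ → ℝ} (hU : ∀ a, IsDiagonalizedBy (Y a) (U a) (p a)) {δ : ℝ} (hδ : 0 < δ) :
    ∃ s, 0 < s ∧ s ≤ 1 ∧
      renyiMoment p g V U s ≤ Real.exp (-(s * (familyCondEntropy Y - δ))) := by
  have hS : (∑ a, Y a).PosSemidef := Matrix.posSemidef_sum _ fun a _ => hY a
  set O : α → κ → l → ℝ := fun a k y => Complex.normSq ((Vᴴ * U a) y k) with hO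
  have hcol : ∀ a k, ∑ y, O a k y = 1 := fun a k =>
    sum_normSq_col (unitary_overlap (hU a).conjTranspose_mul_self (hU a).mul_conjTranspose_self
      hV.conjTranspose_mul_self hV.mul_conjTranspose_self).1 k
  have hp : ∀ a k, 0 ≤ p a k := fun a k => (hU a).nonneg (hY a) k
  have hg : ∀ y, 0 ≤ g y := hV.nonneg hS
  set L : α → κ → l → ℝ := fun a k y => Real.log (p a k) - Real.log (g y) with hL
  set ψ : ℝ → ℝ := fun s => ∑ a, ∑ k, ∑ y, p a k * O a k y * Real.exp (s * L a k y) with hψ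
  have heq : ∀ s, 0 < s → renyiMoment p g V U s = ψ s := by
    intro s hs
    refine Finset.sum_congr rfl fun a _ => Finset.sum_congr rfl fun k _ =>
      Finset.sum_congr rfl fun y _ => ?_
    change p a k ^ (1 + s) * g y ^ (-s) * O a k y = _
    rcases (hp a k).eq_or_lt with h1 | h1
    · rw [← h1, Real.zero_rpow (by linarith)]; simp
    -- If g y = 0, then Y_a ≤ S forces zero overlap with eigenvectors of positive eigenvalue, and
    -- the term vanishes in both forms.
    rcases (hg y).eq_or_lt with h2 | h2
    · have h3 := hV.conj_diag_eq_zero (hY a) (Matrix.posSemidef_sum_sub hY (Finset.mem_univ a))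
        h2.symm
      rw [(hU a).conj_diag_eq V y, Finset.sum_eq_zero_iff_of_nonneg
        (fun j _ => mul_nonneg (hp a j) (Complex.normSq_nonneg _))] at h3
      have h4 : O a k y = 0 := (mul_eq_zero.1 (h3 k (Finset.mem_univ _))).resolve_left h1.ne'
      rw [h4]; simp
    · rw [Real.rpow_add h1, Real.rpow_one, Real.rpow_def_of_pos h1, Real.rpow_def_of_pos h2, hL,
        mul_sub, sub_eq_add_neg, Real.exp_add]
      ring_nf
  have hψ0 : ψ 0 = 1 := by
    simp only [hψ, zero_mul, Real.exp_zero, mul_one, ← Finset.mul_sum, hcol]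
    rw [Finset.sum_congr rfl fun a _ => (hU a).trace_eq.symm, ← Complex.re_sum,
      ← Matrix.trace_sum, htr, Complex.one_re]
  have hderiv : HasDerivAt ψ (-familyCondEntropy Y) 0 := by
    have h1 : HasDerivAt ψ (∑ a, ∑ k, ∑ y, p a k * O a k y * L a k y) 0 := by
      refine HasDerivAt.fun_sum fun a _ => HasDerivAt.fun_sum fun k _ =>
        HasDerivAt.fun_sum fun y _ => ?_
      have h2 : HasDerivAt (fun s : ℝ => Real.exp (s * L a k y)) (L a k y) 0 := by
        simpa using ((hasDerivAt_id (0 : ℝ)).mul_const (L a k y)).exp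
      exact h2.const_mul _
    convert h1 using 1
    have h3 : ∀ a, -vonNeumannEntropy (Y a) = ∑ k, ∑ y, p a k * O a k y * Real.log (p a k) := by
      intro a
      rw [(hU a).vonNeumannEntropy_eq, ← Finset.sum_neg_distrib]
      refine Finset.sum_congr rfl fun k _ => ?_
      rw [← Finset.sum_mul, ← Finset.mul_sum, hcol, Real.negMulLog]
      ring
    have h4 : vonNeumannEntropy (∑ a, Y a)
        = -∑ a, ∑ k, ∑ y, p a k * O a k y * Real.log (g y) := by
      rw [vonNeumannEntropy, Finset.sum_mul, Matrix.trace_sum, Complex.re_sum]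
      congr 1
      refine Finset.sum_congr rfl fun a _ => ?_
      rw [hV.trace_mul_matrixLog, Finset.sum_comm]
      refine Finset.sum_congr rfl fun y _ => ?_
      rw [(hU a).conj_diag_eq V y, ← Finset.sum_mul, mul_comm]
    have h5 := Finset.sum_congr rfl fun a (_ : a ∈ Finset.univ) => h3 a
    rw [Finset.sum_neg_distrib] at h5
    simp only [hL, mul_sub, Finset.sum_sub_distrib]
    rw [familyCondEntropy]
    linarith
  have hslope := (hasDerivAt_iff_tendsto_slope_zero.1 hderiv).mono_left
    (nhdsWithin_mono (0 : ℝ) (fun x (hx : x ∈ Set.Ioi (0 : ℝ)) => (ne_of_gt hx : x ≠ 0)))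
  have hev : ∀ᶠ s in 𝓝[>] (0 : ℝ), s⁻¹ • (ψ (0 + s) - ψ 0) < -familyCondEntropy Y + δ :=
    hslope.eventually_lt_const (by linarith)
  have hle : ∀ᶠ s in 𝓝[>] (0 : ℝ), s ≤ 1 :=
    mem_of_superset (Ioc_mem_nhdsGT zero_lt_one) fun s hs => hs.2
  obtain ⟨s, ⟨h1, h2⟩, h3⟩ := ((hev.and hle).and self_mem_nhdsWithin).exists
  have hs : 0 < s := h3
  refine ⟨s, hs, h2, ?_⟩
  rw [heq s hs]
  rw [zero_add, hψ0, smul_eq_mul, inv_mul_lt_iff₀ hs] at h1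
  have := Real.add_one_le_exp (-(s * (familyCondEntropy Y - δ)))
  linarith

end renyi

/-! ### Asymptotics of random hashing -/

section asymptotics

theorem half_exp_le_floor {x : ℝ} (hx : 0 ≤ x) : Real.exp x / 2 ≤ ⌊Real.exp x⌋₊ := by
  have h1 : (1 : ℝ) ≤ ⌊Real.exp x⌋₊ := by
    exact_mod_cast Nat.le_floor (by simpa using Real.one_le_exp hx)
  have h2 := Nat.lt_floor_add_one (Real.exp x)
  linarith

theorem neZero_floor_exp {x : ℝ} (hx : 0 ≤ x) : NeZero ⌊Real.exp x⌋₊ :=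
  ⟨Nat.one_le_iff_ne_zero.1 (Nat.le_floor (by simpa using Real.one_le_exp hx))⟩

theorem tendsto_log_succ_div : Tendsto (fun n : ℕ => Real.log (n + 1) / n) atTop (𝓝 0) := by
  have h1 : Tendsto (fun x : ℝ => Real.log x / (1 * x + (-1))) atTop (𝓝 0) := by
    simpa using Real.tendsto_pow_log_div_mul_add_atTop 1 (-1) 1 one_ne_zero
  have h2 := h1.comp (tendsto_natCast_atTop_atTop.comp (tendsto_add_atTop_nat 1))
  refine h2.congr fun n => ?_
  simp

variable {α d : Type*} [Fintype α] [DecidableEq α] [Fintype d] [DecidableEq d]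
  {Y : α → Matrix d d ℂ}

/-- Asymptotic performance of random hashing for i.i.d. sources. -/
theorem eventually_average_neg_familyCondEntropy_le (hY : ∀ a, (Y a).PosSemidef)
    (htr : (∑ a, Y a).trace = 1) {R : ℝ} (hR : 0 < R) {δ : ℝ} (hδ : 0 < δ) :
    ∀ᶠ n : ℕ in atTop,
      (Fintype.card ((Fin n → α) → Fin ⌊Real.exp (n * R)⌋₊) : ℝ)⁻¹ *
        ∑ f : (Fin n → α) → Fin ⌊Real.exp (n * R)⌋₊,
          -familyCondEntropy (pushFamily f (powFamily Y n)) ≤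
      -(n * (min R (familyCondEntropy Y) - δ)) := by
  set h := familyCondEntropy Y with hh
  set m := min R h with hm
  have hU := fun a => IsDiagonalizedBy.of_isHermitian (hY a).1
  have hSps := Matrix.posSemidef_sum Finset.univ fun a (_ : a ∈ Finset.univ) => hY a
  have hV := IsDiagonalizedBy.of_isHermitian hSps.1
  set V := (hSps.1.eigenvectorUnitary : Matrix d d ℂ)
  set g := hSps.1.eigenvalues
  set U := fun a => ((hY a).1.eigenvectorUnitary : Matrix d d ℂ)
  set p := fun a => (hY a).1.eigenvalues
  have hp : ∀ a k, 0 ≤ p a k := fun a k => (hU a).nonneg (hY a) k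
  have hg : ∀ y, 0 ≤ g y := hV.nonneg hSps
  -- Half of δ goes to the moment; the other half absorbs the logarithm of the number of types and
  -- the constant.
  obtain ⟨s, hs, hs1, hφ⟩ := exists_renyiMoment_le hY htr hV hU (half_pos hδ)
  have hφ0 : 0 ≤ renyiMoment p g V U s :=
    Finset.sum_nonneg fun a _ => Finset.sum_nonneg fun k _ => Finset.sum_nonneg fun y _ =>
      mul_nonneg (mul_nonneg (Real.rpow_nonneg (hp a k) _) (Real.rpow_nonneg (hg y) _))
        (Complex.normSq_nonneg _)
  have hbound : ∀ n : ℕ,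
      (Fintype.card ((Fin n → α) → Fin ⌊Real.exp (n * R)⌋₊) : ℝ)⁻¹ *
        ∑ f : (Fin n → α) → Fin ⌊Real.exp (n * R)⌋₊,
          -familyCondEntropy (pushFamily f (powFamily Y n)) ≤
      Fintype.card d * Real.log (n + 1) + 1 / s * Real.log 3 - n * (m - δ / 2) := by
    intro n
    have hnR : 0 ≤ n * R := by positivity
    have := neZero_floor_exp hnR
    have h1 := average_neg_familyCondEntropy_le (Y := powFamily Y n) (M := ⌊Real.exp (n * R)⌋₊)
      (fun x => tensorPi_posSemidef fun i => hY (x i))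
      (by rw [sum_powFamily_trace htr, Complex.one_re])
      (τ := letterCount) (g := fun t => ∏ e, g e ^ (t e : ℕ)) (V := tensorPi fun _ => V)
      (by
        simp_rw [prod_pow_letterCount]
        simp only [powFamily]
        rw [sum_tensorPi]
        exact IsDiagonalizedBy.tensorPi fun _ => hV)
      (fun x => IsDiagonalizedBy.tensorPi fun i => hU (x i)) hs hs1
    simp_rw [prod_pow_letterCount] at h1
    change _ ≤ _ + 1 / s * Real.log (renyiMoment (fun (x : Fin n → α) k => ∏ i, p (x i) (k i))
      (fun y => ∏ i, g (y i)) (tensorPi fun _ => V) (fun x => tensorPi fun i => U (x i)) s + _)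
      at h1
    rw [renyiMoment_pow hp hg] at h1
    refine h1.trans ?_
    -- Common scale of the two terms: the moment is at most E and M^(-s) at most 2E, where the 2
    -- pays for rounding exp(nR) down. This is the origin of log 3.
    set E := Real.exp (-(n * s * (m - δ / 2))) with hE
    have hlogT : Real.log (Fintype.card (d → Fin (n + 1))) = Fintype.card d * Real.log (n + 1) := by
      rw [Fintype.card_fun, Fintype.card_fin]
      push_cast
      rw [Real.log_pow]
    have h2 : renyiMoment p g V U s ^ n ≤ E := by
      refine (pow_le_pow_left₀ hφ0 hφ n).trans ?_
      rw [← Real.exp_nat_mul]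
      apply Real.exp_le_exp.2
      have : m ≤ h := min_le_right _ _
      have h3 : n * s * (m - δ / 2) ≤ n * s * (h - δ / 2) :=
        mul_le_mul_of_nonneg_left (by linarith) (by positivity)
      linarith
    have hMpos : (0 : ℝ) < ⌊Real.exp (n * R)⌋₊ := by
      exact_mod_cast NeZero.pos ⌊Real.exp (n * R)⌋₊
    have h4 : ((⌊Real.exp (n * R)⌋₊ : ℝ)⁻¹) ^ s ≤ 2 * E := by
      have h5 : (⌊Real.exp (n * R)⌋₊ : ℝ)⁻¹ ≤ 2 * Real.exp (-(n * R)) := by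
        rw [Real.exp_neg, inv_le_comm₀ hMpos (by positivity), mul_inv, inv_inv]
        linarith [half_exp_le_floor hnR]
      refine (Real.rpow_le_rpow (by positivity) h5 hs.le).trans ?_
      rw [Real.mul_rpow (by norm_num) (Real.exp_pos _).le, ← Real.exp_mul]
      have h6 : (2 : ℝ) ^ s ≤ 2 := by
        simpa using Real.rpow_le_rpow_of_exponent_le (one_le_two) hs1
      refine mul_le_mul h6 (Real.exp_le_exp.2 ?_) (Real.exp_pos _).le (by norm_num)
      have : m ≤ R := min_le_left _ _
      have h3 : n * s * (m - δ / 2) ≤ n * s * R :=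
        mul_le_mul_of_nonneg_left (by linarith) (by positivity)
      linarith
    have h7 : Real.log (renyiMoment p g V U s ^ n + ((⌊Real.exp (n * R)⌋₊ : ℝ)⁻¹) ^ s)
        ≤ Real.log 3 - n * s * (m - δ / 2) := by
      have h8 : 0 < renyiMoment p g V U s ^ n + ((⌊Real.exp (n * R)⌋₊ : ℝ)⁻¹) ^ s :=
        add_pos_of_nonneg_of_pos (pow_nonneg hφ0 n) (Real.rpow_pos_of_pos (inv_pos.2 hMpos) s)
      have h9 := Real.log_le_log h8 (by linarith : _ ≤ 3 * E)
      rw [Real.log_mul (by norm_num) (Real.exp_pos _).ne', Real.log_exp] at h9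
      linarith
    rw [hlogT]
    have h10 := mul_le_mul_of_nonneg_left h7 (by positivity : 0 ≤ 1 / s)
    have h11 : 1 / s * (Real.log 3 - n * s * (m - δ / 2))
        = 1 / s * Real.log 3 - n * (m - δ / 2) := by field_simp
    linarith
  have hlim : Tendsto (fun n : ℕ => (Fintype.card d * Real.log (n + 1) + 1 / s * Real.log 3) / n)
      atTop (𝓝 0) := by
    have := (tendsto_log_succ_div.const_mul (Fintype.card d : ℝ)).add
      (tendsto_const_div_atTop_nhds_zero_nat (1 / s * Real.log 3))
    rw [mul_zero, add_zero] at this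
    exact this.congr fun n => by ring
  filter_upwards [hlim.eventually_lt_const (half_pos hδ), eventually_gt_atTop 0] with n hn hn0
  have hn' : (0 : ℝ) < n := by exact_mod_cast hn0
  rw [div_lt_iff₀ hn'] at hn
  refine (hbound n).trans ?_
  nlinarith

/-- The entropy of the classical index. -/
noncomputable def familyEntropy {α d : Type*} [Fintype α] [Fintype d]
    (Y : α → Matrix d d ℂ) : ℝ :=
  ∑ a, Real.negMulLog (Y a).trace.re

theorem vonNeumannEntropy_of_unique {d : Type*} [Unique d] [Fintype d] [DecidableEq d]
    {A : Matrix d d ℂ} (hA : A.IsHermitian) :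
    vonNeumannEntropy A = Real.negMulLog A.trace.re := by
  have h := IsDiagonalizedBy.of_isHermitian hA
  rw [h.vonNeumannEntropy_eq, h.trace_eq, Fintype.sum_unique, Fintype.sum_unique]

theorem familyCondEntropy_of_unique {α d : Type*} [Fintype α] [Unique d] [Fintype d]
    [DecidableEq d] {Y : α → Matrix d d ℂ} (hY : ∀ a, (Y a).PosSemidef)
    (htr : (∑ a, Y a).trace = 1) : familyCondEntropy Y = familyEntropy Y := by
  rw [familyCondEntropy, vonNeumannEntropy_of_unique (Matrix.posSemidef_sum _ fun a _ => hY a).1,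
    htr, Complex.one_re, Real.negMulLog_one, sub_zero]
  exact Finset.sum_congr rfl fun a _ => vonNeumannEntropy_of_unique (hY a).1

/-- The family of the classical marginal. -/
def traceFamily {α d : Type*} [Fintype d] (Y : α → Matrix d d ℂ) (a : α) :
    Matrix Unit Unit ℂ :=
  Matrix.diagonal fun _ => (Y a).trace

theorem traceFamily_posSemidef {α d : Type*} [Fintype d] {Y : α → Matrix d d ℂ}
    (hY : ∀ a, (Y a).PosSemidef) (a : α) : (traceFamily Y a).PosSemidef :=
  Matrix.PosSemidef.diagonal fun _ => (hY a).trace_nonneg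

theorem traceFamily_trace {α d : Type*} [Fintype d] (Y : α → Matrix d d ℂ) (a : α) :
    (traceFamily Y a).trace = (Y a).trace := by
  rw [traceFamily, Matrix.trace_diagonal, Finset.sum_const, Finset.card_univ, Fintype.card_unit,
    one_smul]

theorem sum_traceFamily_trace {α d : Type*} [Fintype α] [Fintype d] {Y : α → Matrix d d ℂ}
    (htr : (∑ a, Y a).trace = 1) : (∑ a, traceFamily Y a).trace = 1 := by
  simp_rw [Matrix.trace_sum, traceFamily_trace, ← Matrix.trace_sum, htr]

theorem familyEntropy_congr {α d d' : Type*} [Fintype α] [Fintype d] [Fintype d']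
    {Y : α → Matrix d d ℂ} {Y' : α → Matrix d' d' ℂ} (h : ∀ a, (Y a).trace = (Y' a).trace) :
    familyEntropy Y = familyEntropy Y' := by
  simp only [familyEntropy, h]

theorem powFamily_posSemidef {α d : Type*} [Fintype d] [DecidableEq d] {Y : α → Matrix d d ℂ}
    (hY : ∀ a, (Y a).PosSemidef) (n : ℕ) (x : Fin n → α) : (powFamily Y n x).PosSemidef :=
  tensorPi_posSemidef fun i => hY (x i)

/-- Tracing out E commutes with tensor powers and with hashing. The output entropy is thus itself a
conditional entropy, against a one-dimensional E, and uniformity becomes a case of the hashing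
bound. -/
theorem familyCondEntropy_pushFamily_powFamily_traceFamily {α β d : Type*} [Fintype α]
    [Fintype d] [Fintype β] [DecidableEq β] {Y : α → Matrix d d ℂ}
    (hY : ∀ a, (Y a).PosSemidef) (htr : (∑ a, Y a).trace = 1) {n : ℕ} (f : (Fin n → α) → β) :
    familyCondEntropy (pushFamily f (powFamily (traceFamily Y) n))
      = familyEntropy (pushFamily f (powFamily Y n)) := by
  rw [familyCondEntropy_of_unique
    (pushFamily_posSemidef (powFamily_posSemidef (traceFamily_posSemidef hY) n))
    (by rw [sum_pushFamily, sum_powFamily_trace (sum_traceFamily_trace htr)])]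
  refine familyEntropy_congr fun b => ?_
  simp only [pushFamily, Matrix.trace_sum, powFamily, tensorPi_trace, traceFamily_trace]

/-- Gibbs' inequality against the uniform distribution, from log x ≤ x - 1 at x = 1/(Mq). -/
theorem familyEntropy_le_log_card {β d : Type*} [Fintype β] [Fintype d]
    {Y : β → Matrix d d ℂ} (hY : ∀ a, (Y a).PosSemidef) (htr : (∑ a, Y a).trace = 1) :
    familyEntropy Y ≤ Real.log (Fintype.card β) := by
  have hβ : Nonempty β := by
    by_contra h
    rw [not_nonempty_iff] at h
    simp at htr
  set M : ℝ := (Fintype.card β : ℝ) with hM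
  have hM0 : 0 < M := by rw [hM]; exact_mod_cast Fintype.card_pos (α := β)
  have hsum : ∑ b, (Y b).trace.re = 1 := by
    rw [← Complex.re_sum, ← Matrix.trace_sum, htr, Complex.one_re]
  have key : ∀ b, Real.negMulLog (Y b).trace.re
      ≤ (Y b).trace.re * Real.log M + (M⁻¹ - (Y b).trace.re) := by
    intro b
    set q := (Y b).trace.re with hq
    have h0 : 0 ≤ q := (Complex.nonneg_iff.1 (hY b).trace_nonneg).1
    rcases h0.eq_or_lt with h | h
    · rw [← h]; simp [hM0.le]
    · have h1 := Real.log_le_sub_one_of_pos (inv_pos.2 (mul_pos hM0 h))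
      rw [Real.log_inv, Real.log_mul hM0.ne' h.ne'] at h1
      have h2 := mul_le_mul_of_nonneg_left h1 h.le
      have h3 : q * ((M * q)⁻¹ - 1) = M⁻¹ - q := by field_simp
      rw [Real.negMulLog]
      linarith
  have h2 := Finset.sum_le_sum fun b (_ : b ∈ Finset.univ) => key b
  rw [Finset.sum_add_distrib, ← Finset.sum_mul, hsum, Finset.sum_sub_distrib, hsum,
    Finset.sum_const, Finset.card_univ, nsmul_eq_mul, ← hM, mul_inv_cancel₀ hM0.ne'] at h2
  rw [familyEntropy]
  linarith

theorem familyEntropy_pushFamily_powFamily_le {α d : Type*} [Fintype α] [Fintype d]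
    [DecidableEq d] {Y : α → Matrix d d ℂ} (hY : ∀ a, (Y a).PosSemidef)
    (htr : (∑ a, Y a).trace = 1) {R : ℝ} (hR : 0 < R) {n : ℕ}
    (f : (Fin n → α) → Fin ⌊Real.exp (n * R)⌋₊) :
    familyEntropy (pushFamily f (powFamily Y n)) ≤ n * R := by
  have := neZero_floor_exp (x := n * R) (by positivity)
  refine (familyEntropy_le_log_card (pushFamily_posSemidef (powFamily_posSemidef hY n))
    (by rw [sum_pushFamily, sum_powFamily_trace htr])).trans ?_
  rw [Fintype.card_fin]
  have h1 := Real.log_le_log (by exact_mod_cast NeZero.pos ⌊Real.exp (n * R)⌋₊)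
    (Nat.floor_le (Real.exp_pos (n * R)).le)
  rwa [Real.log_exp] at h1

theorem familyCondEntropy_pushFamily_powFamily_le {α d : Type*} [Fintype α] [Fintype d]
    [DecidableEq d] {Y : α → Matrix d d ℂ} {β : Type*} [Fintype β] [DecidableEq β]
    (hY : ∀ a, (Y a).PosSemidef) (htr : (∑ a, Y a).trace = 1) {n : ℕ} (f : (Fin n → α) → β) :
    familyCondEntropy (pushFamily f (powFamily Y n)) ≤ n * familyCondEntropy Y := by
  rw [← familyCondEntropy_powFamily hY htr]
  exact familyCondEntropy_pushFamily_le (powFamily_posSemidef hY n)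

theorem familyCondEntropy_pushFamily_powFamily_le_familyEntropy {α d : Type*} [Fintype α] [Fintype d]
    [DecidableEq d] {Y : α → Matrix d d ℂ} {β : Type*} [Fintype β]
    [DecidableEq β] (hY : ∀ a, (Y a).PosSemidef) (htr : (∑ a, Y a).trace = 1) {n : ℕ}
    (f : (Fin n → α) → β) :
    familyCondEntropy (pushFamily f (powFamily Y n))
      ≤ familyEntropy (pushFamily f (powFamily Y n)) :=
  familyCondEntropy_le (pushFamily_posSemidef (powFamily_posSemidef hY n))
    (by rw [sum_pushFamily, sum_powFamily_trace htr, Complex.one_re])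

/-- There are maps with asymptotically uniform output whose equivocation is optimal. -/
theorem exists_keyMaps_tendsto (hY : ∀ a, (Y a).PosSemidef) (htr : (∑ a, Y a).trace = 1) {R : ℝ}
    (hR : 0 < R) (hRY : R ≤ familyEntropy Y) :
    ∃ f : KeyMaps α R,
      Tendsto (fun n : ℕ => familyEntropy (pushFamily (f n) (powFamily Y n)) / n) atTop (𝓝 R) ∧
      Tendsto (fun n : ℕ => familyCondEntropy (pushFamily (f n) (powFamily Y n)) / n) atTop
        (𝓝 (min R (familyCondEntropy Y))) := by
  set m := min R (familyCondEntropy Y) with hm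
  -- Deficit of uniformity plus deficit of equivocation. Both are nonnegative, so a minimizer of the
  -- sum, which does no worse than a random map, controls each of them.
  let D : (n : ℕ) → ((Fin n → α) → Fin ⌊Real.exp (n * R)⌋₊) → ℝ := fun n f =>
    (n * R - familyEntropy (pushFamily f (powFamily Y n)))
      + (n * m - familyCondEntropy (pushFamily f (powFamily Y n)))
  have hA : ∀ n f, 0 ≤ n * R - familyEntropy (pushFamily f (powFamily Y n)) :=
    fun n (f : (Fin n → α) → Fin ⌊Real.exp (n * R)⌋₊) =>
      sub_nonneg.2 (familyEntropy_pushFamily_powFamily_le hY htr hR f)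
  have hB : ∀ n (f : (Fin n → α) → Fin ⌊Real.exp (n * R)⌋₊),
      0 ≤ n * m - familyCondEntropy (pushFamily f (powFamily Y n)) := by
    intro n f
    rw [sub_nonneg, hm, mul_min_of_nonneg _ _ (Nat.cast_nonneg n)]
    exact le_min ((familyCondEntropy_pushFamily_powFamily_le_familyEntropy hY htr f).trans
      (familyEntropy_pushFamily_powFamily_le hY htr hR f))
      (familyCondEntropy_pushFamily_powFamily_le hY htr f)
  have hmin : ∀ n, ∃ f, ∀ f', D n f ≤ D n f' := fun n => by
    have := neZero_floor_exp (x := n * R) (by positivity)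
    exact Finite.exists_min (D n)
  choose f hf using hmin
  have hD0 : ∀ n, 0 ≤ D n (f n) / n := fun n =>
    div_nonneg (add_nonneg (hA n (f n)) (hB n (f n))) (Nat.cast_nonneg n)
  -- Here R ≤ H(A) enters: for the classical marginal the hashing bound attains the full rate R.
  have hminA : min R (familyCondEntropy (traceFamily Y)) = R := by
    rw [familyCondEntropy_of_unique (traceFamily_posSemidef hY) (sum_traceFamily_trace htr),
      familyEntropy_congr (traceFamily_trace Y), min_eq_left hRY]
  have hDlim : Tendsto (fun n : ℕ => D n (f n) / n) atTop (𝓝 0) := by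
    refine tendsto_order.2 ⟨fun b hb => Eventually.of_forall fun n => hb.trans_le (hD0 n),
      fun b hb => ?_⟩
    have hb3 : 0 < b / 3 := by linarith
    filter_upwards [eventually_average_neg_familyCondEntropy_le hY htr hR hb3,
      eventually_average_neg_familyCondEntropy_le (traceFamily_posSemidef hY)
        (sum_traceFamily_trace htr) hR hb3, eventually_gt_atTop 0] with n h1 h2 hn
    have hn' : (0 : ℝ) < n := by exact_mod_cast hn
    have := neZero_floor_exp (x := n * R) (by positivity)
    rw [hminA] at h2
    simp_rw [familyCondEntropy_pushFamily_powFamily_traceFamily hY htr] at h2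
    rw [← hm] at h1
    set N : ℝ := (Fintype.card ((Fin n → α) → Fin ⌊Real.exp (n * R)⌋₊) : ℝ) with hN
    have hN0 : 0 < N := by
      rw [hN]
      exact_mod_cast Fintype.card_pos (α := (Fin n → α) → Fin ⌊Real.exp (n * R)⌋₊)
    have h3 : D n (f n) ≤ N⁻¹ * ∑ f', D n f' := by
      rw [inv_mul_eq_div, le_div_iff₀ hN0, mul_comm, hN, ← nsmul_eq_mul, ← Finset.card_univ]
      exact Finset.card_nsmul_le_sum _ _ _ fun f' _ => hf n f'
    have h4 : N⁻¹ * ∑ f', D n f' = n * R + n * m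
        + N⁻¹ * ∑ f' : (Fin n → α) → Fin ⌊Real.exp (n * R)⌋₊,
            -familyEntropy (pushFamily f' (powFamily Y n))
        + N⁻¹ * ∑ f' : (Fin n → α) → Fin ⌊Real.exp (n * R)⌋₊,
            -familyCondEntropy (pushFamily f' (powFamily Y n)) := by
      simp only [D, sub_eq_add_neg, Finset.sum_add_distrib, Finset.sum_const, Finset.card_univ,
        nsmul_eq_mul, ← hN]
      field_simp
      ring
    rw [div_lt_iff₀ hn']
    nlinarith
  have hlimA : Tendsto (fun n : ℕ =>
      (n * R - familyEntropy (pushFamily (f n) (powFamily Y n))) / n) atTop (𝓝 0) :=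
    squeeze_zero (fun n => div_nonneg (hA n (f n)) (Nat.cast_nonneg n))
      (fun n => div_le_div_of_nonneg_right (le_add_of_nonneg_right (hB n (f n)))
        (Nat.cast_nonneg n)) hDlim
  have hlimB : Tendsto (fun n : ℕ =>
      (n * m - familyCondEntropy (pushFamily (f n) (powFamily Y n))) / n) atTop (𝓝 0) :=
    squeeze_zero (fun n => div_nonneg (hB n (f n)) (Nat.cast_nonneg n))
      (fun n => div_le_div_of_nonneg_right (le_add_of_nonneg_left (hA n (f n)))
        (Nat.cast_nonneg n)) hDlim
  refine ⟨f, ?_, ?_⟩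
  · have := hlimA.const_sub R
    rw [sub_zero] at this
    refine this.congr' ?_
    filter_upwards [eventually_gt_atTop 0] with n hn
    have hn' : (n : ℝ) ≠ 0 := by exact_mod_cast hn.ne'
    field_simp
    ring
  · have := hlimB.const_sub m
    rw [sub_zero] at this
    refine this.congr' ?_
    filter_upwards [eventually_gt_atTop 0] with n hn
    have hn' : (n : ℝ) ≠ 0 := by exact_mod_cast hn.ne'
    field_simp
    ring

end asymptotics

/-! ### Classical-quantum states as block families -/

section classicalQuantum

/-- The classical-quantum state of a family of unnormalized states. -/
def blockFamily {β ε κ : Type*} [DecidableEq β] (σ : β → Matrix ε κ ℂ) :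
    Matrix (β × ε) (β × κ) ℂ :=
  Matrix.of fun x y => if x.1 = y.1 then σ x.1 x.2 y.2 else 0

theorem blockFamily_mul {β ε κ ι : Type*} [Fintype β] [DecidableEq β] [Fintype κ]
    (σ : β → Matrix ε κ ℂ) (τ : β → Matrix κ ι ℂ) :
    blockFamily σ * blockFamily τ = blockFamily fun b => σ b * τ b := by
  ext ⟨b, x⟩ ⟨b', y⟩
  simp only [blockFamily, Matrix.mul_apply, Matrix.of_apply, Fintype.sum_prod_type]
  rw [Finset.sum_eq_single b (fun c _ hc => by simp [Ne.symm hc]) (by simp)]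
  by_cases h : b = b' <;> simp [h]

theorem blockFamily_conjTranspose {β ε κ : Type*} [DecidableEq β] (σ : β → Matrix ε κ ℂ) :
    (blockFamily σ)ᴴ = blockFamily fun b => (σ b)ᴴ := by
  ext ⟨b, x⟩ ⟨b', y⟩
  simp only [blockFamily, Matrix.conjTranspose_apply, Matrix.of_apply]
  by_cases h : b = b'
  · subst h; simp
  · simp [h, Ne.symm h]

theorem blockFamily_diagonal {β ε : Type*} [DecidableEq β] [DecidableEq ε] (c : β → ε → ℂ) :
    blockFamily (fun b => Matrix.diagonal (c b)) = Matrix.diagonal fun x => c x.1 x.2 := by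
  ext ⟨b, x⟩ ⟨b', y⟩
  simp only [blockFamily, Matrix.of_apply, Matrix.diagonal_apply, Prod.mk.injEq]
  by_cases h : b = b' <;> simp [h]

theorem blockFamily_one {β ε : Type*} [DecidableEq β] [DecidableEq ε] :
    blockFamily (fun _ : β => (1 : Matrix ε ε ℂ)) = 1 := by
  simp only [← Matrix.diagonal_one]
  rw [blockFamily_diagonal]

theorem IsDiagonalizedBy.blockFamily {β d k : Type*} [Fintype β] [DecidableEq β] [Fintype d]
    [DecidableEq d] [Fintype k] [DecidableEq k] {A : β → Matrix d d ℂ} {W : β → Matrix d k ℂ}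
    {c : β → k → ℝ} (h : ∀ b, IsDiagonalizedBy (A b) (W b) (c b)) :
    IsDiagonalizedBy (blockFamily A) (blockFamily W) (fun x => c x.1 x.2) where
  conjTranspose_mul_self := by
    rw [blockFamily_conjTranspose, blockFamily_mul]
    simp_rw [(h _).conjTranspose_mul_self]
    exact blockFamily_one
  mul_conjTranspose_self := by
    rw [blockFamily_conjTranspose, blockFamily_mul]
    simp_rw [(h _).mul_conjTranspose_self]
    exact blockFamily_one
  eq_conj := by
    rw [← blockFamily_diagonal fun b x => (c b x : ℂ), blockFamily_conjTranspose,
      blockFamily_mul, blockFamily_mul]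
    exact congrArg _ (funext fun b => (h b).eq_conj)

variable {β ε : Type*} [Fintype β] [DecidableEq β] [Fintype ε] [DecidableEq ε]
  {σ : β → Matrix ε ε ℂ}

theorem vonNeumannEntropy_blockFamily (hσ : ∀ b, (σ b).IsHermitian) :
    vonNeumannEntropy (blockFamily σ) = ∑ b, vonNeumannEntropy (σ b) := by
  have h := fun b => IsDiagonalizedBy.of_isHermitian (hσ b)
  rw [(IsDiagonalizedBy.blockFamily h).vonNeumannEntropy_eq, Fintype.sum_prod_type]
  exact Finset.sum_congr rfl fun b _ => (h b).vonNeumannEntropy_eq.symm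

theorem reducedE_blockFamily {β ε : Type*} [Fintype β] [DecidableEq β] (σ : β → Matrix ε ε ℂ) :
    reducedE (blockFamily σ) = ∑ b, σ b := by
  ext x y
  simp [reducedE, blockFamily, Matrix.sum_apply]

theorem reducedA_blockFamily {β ε : Type*} [DecidableEq β] [Fintype ε] (σ : β → Matrix ε ε ℂ) :
    reducedA (blockFamily σ) = Matrix.diagonal fun b => (σ b).trace := by
  ext b b'
  simp only [reducedA, blockFamily, Matrix.of_apply, Matrix.diagonal_apply]
  by_cases h : b = b' <;> simp [h, Matrix.trace]

theorem reducedA_blockFamily_of_posSemidef {β ε : Type*} [DecidableEq β] [Fintype ε]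
    {σ : β → Matrix ε ε ℂ} (hσ : ∀ b, (σ b).PosSemidef) :
    reducedA (blockFamily σ) = Matrix.diagonal fun b => ((σ b).trace.re : ℂ) := by
  rw [reducedA_blockFamily]
  exact congrArg _ (funext fun b =>
    Complex.ext rfl (Complex.nonneg_iff.1 (hσ b).trace_nonneg).2.symm)

theorem condEntropy_blockFamily (hσ : ∀ b, (σ b).PosSemidef) :
    condEntropy (blockFamily σ) = familyCondEntropy σ := by
  rw [condEntropy, vonNeumannEntropy_blockFamily fun b => (hσ b).1, reducedE_blockFamily,
    familyCondEntropy]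

theorem entropyA_blockFamily {β ε : Type*} [Fintype β] [DecidableEq β] [Fintype ε]
    {σ : β → Matrix ε ε ℂ} (hσ : ∀ b, (σ b).PosSemidef) :
    entropyA (blockFamily σ) = familyEntropy σ := by
  rw [entropyA, reducedA_blockFamily_of_posSemidef hσ,
    (isDiagonalizedBy_diagonal _).vonNeumannEntropy_eq, familyEntropy]

theorem mutualInfo_blockFamily (hσ : ∀ b, (σ b).PosSemidef) :
    mutualInfo (blockFamily σ) = familyEntropy σ - familyCondEntropy σ := by
  have hS := Matrix.posSemidef_sum Finset.univ fun b (_ : b ∈ Finset.univ) => hσ b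
  have hV := IsDiagonalizedBy.of_isHermitian hS.1
  set V := (hS.1.eigenvectorUnitary : Matrix ε ε ℂ)
  set g := hS.1.eigenvalues
  have hkron : reducedA (blockFamily σ) ⊗ₖ reducedE (blockFamily σ)
      = blockFamily fun b => ((σ b).trace.re : ℂ) • ∑ b, σ b := by
    rw [reducedA_blockFamily_of_posSemidef hσ, reducedE_blockFamily]
    ext ⟨b, x⟩ ⟨b', y⟩
    simp only [Matrix.kroneckerMap_apply, Matrix.diagonal_apply, blockFamily, Matrix.of_apply,
      Matrix.smul_apply, smul_eq_mul]
    split_ifs <;> simp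
  have hdec : IsDiagonalizedBy (blockFamily fun b => ((σ b).trace.re : ℂ) • ∑ b, σ b)
      (blockFamily fun _ => V) (fun x => (σ x.1).trace.re * g x.2) :=
    IsDiagonalizedBy.blockFamily (c := fun b y => (σ b).trace.re * g y) fun b => by
      simpa using hV.smul_add_smul_one (σ b).trace.re 0
  have hconj : (blockFamily fun _ : β => V)ᴴ * blockFamily σ * blockFamily (fun _ => V)
      = blockFamily fun b => Vᴴ * σ b * V := by
    rw [blockFamily_conjTranspose, blockFamily_mul, blockFamily_mul]
  have hcross : (blockFamily σ * matrixLog (reducedA (blockFamily σ)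
      ⊗ₖ reducedE (blockFamily σ))).trace.re
      = -familyEntropy σ - vonNeumannEntropy (∑ b, σ b) := by
    rw [hkron, hdec.trace_mul_matrixLog, hconj, Fintype.sum_prod_type]
    have h1 : ∀ b, ∑ y, Real.log ((σ b).trace.re * g y)
          * (blockFamily (fun b => Vᴴ * σ b * V) (b, y) (b, y)).re
        = -Real.negMulLog (σ b).trace.re + (σ b * matrixLog (∑ b, σ b)).trace.re := by
      intro b
      have h2 : -Real.negMulLog (σ b).trace.re
          = ∑ y, Real.log (σ b).trace.re * ((Vᴴ * σ b * V) y y).re := by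
        have h3 : (σ b).trace = (Vᴴ * σ b * V).trace := by
          rw [Matrix.trace_mul_comm, ← Matrix.mul_assoc, hV.mul_conjTranspose_self,
            Matrix.one_mul]
        rw [← Finset.mul_sum, ← Complex.re_sum]
        change _ = _ * (Vᴴ * σ b * V).trace.re
        rw [← h3, Real.negMulLog]
        ring
      rw [h2, hV.trace_mul_matrixLog, ← Finset.sum_add_distrib]
      refine Finset.sum_congr rfl fun y _ => ?_
      have h4 : blockFamily (fun b => Vᴴ * σ b * V) (b, y) (b, y) = (Vᴴ * σ b * V) y y := by
        simp [blockFamily]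
      rw [h4]
      -- log(P(b) g) splits only for nonzero factors. If the trace vanishes then σ_b = 0; if g y = 0
      -- then σ_b ≤ ∑ σ kills the diagonal coefficient. Both cases contribute zero.
      by_cases hq : (σ b).trace.re = 0
      · have h0 : σ b = 0 := by
          rw [← (hσ b).trace_eq_zero_iff]
          exact Complex.ext hq (Complex.nonneg_iff.1 (hσ b).trace_nonneg).2.symm
        simp [h0]
      by_cases hg : g y = 0
      · rw [hV.conj_diag_eq_zero (hσ b) (Matrix.posSemidef_sum_sub hσ (Finset.mem_univ b)) hg]
        simp
      · rw [Real.log_mul hq hg]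
        ring
    rw [Finset.sum_congr rfl fun b _ => h1 b, Finset.sum_add_distrib, Finset.sum_neg_distrib,
      ← Complex.re_sum, ← Matrix.trace_sum, ← Finset.sum_mul, vonNeumannEntropy, familyEntropy]
    ring
  have hself : (blockFamily σ * matrixLog (blockFamily σ)).trace.re
      = -∑ b, vonNeumannEntropy (σ b) := by
    rw [← vonNeumannEntropy_blockFamily fun b => (hσ b).1, vonNeumannEntropy, neg_neg]
  rw [mutualInfo, Matrix.mul_sub, Matrix.trace_sub, Complex.sub_re, hcross, hself,
    familyCondEntropy]
  ring

theorem applyMap_tensorPower_blockFamily {α β ε : Type*} [Fintype α] [DecidableEq α]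
    [DecidableEq β] (Y : α → Matrix ε ε ℂ) {n : ℕ} (f : (Fin n → α) → β) :
    applyMap f (tensorPower (blockFamily Y) n) = blockFamily (pushFamily f (powFamily Y n)) := by
  ext ⟨b, x⟩ ⟨b', y⟩
  simp only [applyMap, Matrix.sum_apply, Matrix.kroneckerMap_apply, Matrix.single_apply,
    Matrix.of_apply, tensorPower, blockFamily, pushFamily, powFamily, tensorPi, if_true]
  by_cases h : b = b'
  · subst h
    rw [if_pos rfl, Finset.sum_filter]
    refine Finset.sum_congr rfl fun a _ => ?_
    by_cases h' : f a = b <;> simp [h']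
  · rw [if_neg h]
    refine Finset.sum_eq_zero fun a _ => ?_
    rw [if_neg (fun h' => h (h'.1.symm.trans h'.2)), zero_mul]

namespace CQEnsemble

variable {α ε : Type*} [Fintype α] [Fintype ε] (ρ : CQEnsemble α ε)

/-- The unnormalized states `P(a) ρ_a`. -/
def family (a : α) : Matrix ε ε ℂ :=
  (ρ.prob a : ℂ) • ρ.state a

theorem family_posSemidef (a : α) : (ρ.family a).PosSemidef :=
  (ρ.state_isDensity a).posSemidef.smul (by exact_mod_cast ρ.prob_nonneg a)

theorem sum_family_trace : (∑ a, ρ.family a).trace = 1 := by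
  simp only [family, Matrix.trace_sum, Matrix.trace_smul, (ρ.state_isDensity _).trace_eq_one,
    smul_eq_mul, mul_one]
  exact_mod_cast ρ.prob_sum

theorem toMatrix_eq [DecidableEq α] : ρ.toMatrix = blockFamily ρ.family := by
  ext ⟨a, x⟩ ⟨a', y⟩
  simp only [toMatrix, Matrix.sum_apply, Matrix.smul_apply, Matrix.kroneckerMap_apply,
    Matrix.single_apply, blockFamily, family, Matrix.of_apply, smul_eq_mul]
  by_cases h : a = a'
  · subst h
    rw [Finset.sum_eq_single a (fun c _ hc => by simp [hc]) (by simp)]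
    simp
  · rw [if_neg h]
    refine Finset.sum_eq_zero fun c _ => ?_
    rw [if_neg (fun h' => h (h'.1.symm.trans h'.2)), zero_mul, mul_zero]

end CQEnsemble

end classicalQuantum

/-! ### The main theorem -/

theorem theorem4 {α ε : Type*} [Fintype α] [DecidableEq α] [Fintype ε] [DecidableEq ε]
    (ρ : CQEnsemble α ε) (R : ℝ) (hR : R ≤ entropyA ρ.toMatrix) :
    (condEntropy ρ.toMatrix < R →
      equivocationRate R ρ.toMatrix = ((condEntropy ρ.toMatrix : ℝ) : EReal)) ∧
    (0 < R →
      leakedInfoRate R ρ.toMatrix = ((max (R - condEntropy ρ.toMatrix) 0 : ℝ) : EReal)) := by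
  have hY := ρ.family_posSemidef
  have htr := ρ.sum_family_trace
  have hpush : ∀ (f : KeyMaps α R) (n : ℕ) b,
      (pushFamily (f n) (powFamily ρ.family n) b).PosSemidef := fun f n =>
    pushFamily_posSemidef (powFamily_posSemidef hY n)
  rw [ρ.toMatrix_eq] at hR ⊢
  rw [entropyA_blockFamily hY] at hR
  rw [condEntropy_blockFamily hY]
  set h := familyCondEntropy ρ.family with hh
  have hunif : ∀ f : KeyMaps α R, 0 < R → (f.AsymptoticallyUniform (blockFamily ρ.family) ↔
      Tendsto (fun n : ℕ => familyEntropy (pushFamily (f n) (powFamily ρ.family n)) / n) atTop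
        (𝓝 R)) := by
    intro f hR0
    rw [KeyMaps.AsymptoticallyUniform]
    simp_rw [applyMap_tensorPower_blockFamily, fun n => entropyA_blockFamily (hpush f n)]
    constructor
    · intro ht
      have := ht.mul_const R
      rw [one_mul] at this
      exact this.congr fun n => by field_simp
    · intro ht
      have := ht.div_const R
      rw [div_self hR0.ne'] at this
      exact this.congr fun n => by rw [div_div]
  constructor
  · intro hhR
    have hR0 : 0 < R := (familyCondEntropy_nonneg hY).trans_lt hhR
    obtain ⟨f, hf1, hf2⟩ := exists_keyMaps_tendsto hY htr hR0 hR
    rw [min_eq_right hhR.le] at hf2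
    refine IsGreatest.csSup_eq ⟨⟨f, h, rfl, (hunif f hR0).2 hf1, ?_⟩, ?_⟩
    · simp_rw [applyMap_tensorPower_blockFamily, fun n => condEntropy_blockFamily (hpush f n)]
      exact hf2
    · rintro _ ⟨f, r, rfl, -, hr⟩
      simp_rw [applyMap_tensorPower_blockFamily, fun n => condEntropy_blockFamily (hpush f n)]
        at hr
      refine EReal.coe_le_coe_iff.2 (le_of_tendsto hr ?_)
      filter_upwards [eventually_gt_atTop 0] with n hn
      rw [div_le_iff₀ (by exact_mod_cast hn)]
      exact (familyCondEntropy_pushFamily_powFamily_le hY htr (f n)).trans_eq (mul_comm _ _)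
  · intro hR0
    obtain ⟨f, hf1, hf2⟩ := exists_keyMaps_tendsto hY htr hR0 hR
    refine IsLeast.csInf_eq ⟨⟨f, _, rfl, (hunif f hR0).2 hf1, ?_⟩, ?_⟩
    · simp_rw [applyMap_tensorPower_blockFamily, fun n => mutualInfo_blockFamily (hpush f n),
        sub_div]
      have hval : max (R - h) 0 = R - min R h := by
        rcases le_total R h with h1 | h1
        · rw [min_eq_left h1, max_eq_right (by linarith), sub_self]
        · rw [min_eq_right h1, max_eq_left (by linarith)]
      rw [hval]
      exact hf1.sub hf2
    · rintro _ ⟨f, r, rfl, hf, hr⟩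
      rw [hunif f hR0] at hf
      simp_rw [applyMap_tensorPower_blockFamily, fun n => mutualInfo_blockFamily (hpush f n)]
        at hr
      -- Uniformity sends the rate of H(f(A)) to R, and data processing bounds the rate of H(f(A)|E)
      -- by h, which gives R - h; the bound by 0 is nonnegativity of mutual information.
      refine EReal.coe_le_coe_iff.2 (max_le ?_ ?_)
      · refine le_of_tendsto_of_tendsto (hf.sub_const h) hr ?_
        filter_upwards [eventually_gt_atTop 0] with n hn
        have hn' : (0 : ℝ) < n := by exact_mod_cast hn
        have h1 := familyCondEntropy_pushFamily_powFamily_le hY htr (f n)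
        rw [sub_div]
        refine sub_le_sub_left ?_ _
        rw [div_le_iff₀ hn']
        exact h1.trans_eq (mul_comm _ _)
      · refine ge_of_tendsto' hr fun n => div_nonneg (sub_nonneg.2 ?_) (Nat.cast_nonneg n)
        exact familyCondEntropy_pushFamily_powFamily_le_familyEntropy hY htr (f n)
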